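/- **Theorem 1.1.** Let $\Gamma$ be a finite simple (no loops, no multiple arcs) strongly connected digraph with vertex set $X$, $|X|\ge 2$. Let $A\in\mathrm{Mat}_X(\mathbb C)$ be its adjacency matrix, $\partial(x,y)$ the length of a shortest directed path from $x$ to $y$, $D=\max_{x,y}\partial(x,y)$ the diameter, $\Gamma_i^{\rightarrow}(x)=\{z:\partial(x,z)=i\}$, $\Gamma_i^{\leftarrow}(x)=\{z:\partial(z,x)=i\}$, and let $A_i$ $(0\le i\le D)$ be the distance-$i$ matrix, $(A_i)_{xy}=1$ if $\partial(x,y)=i$ and $0$ otherwise (so $A_0=I$, $A_1=A$). Let $\mathcal A$ be the adjacency algebra, i.e. the algebra of all complex polynomials in $A$. A partition of $X$ into nonempty cells $P_0,\dots,P_s$ is *equitable* if there are numbers $d^{\rightarrow}_{ij},d^{\leftarrow}_{ij}$ (its parameters) with $|\Gamma_1^{\rightarrow}(y)\cap P_j|=d^{\rightarrow}_{ij}$ and $|\Gamma_1^{\leftarrow}(y)\cap P_j|=d^{\leftarrow}_{ij}$ for all $i,j$ and all $y\in P_i$. A *commutative $d$-class association scheme* on $X$ is a set of $d+1$ nonempty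 relations on $X$ whose $0/1$ matrices $B_0,\dots,B_d$ can be numbered so that $B_0=I$; $\sum_i B_i=J$ (the all-ones matrix); each $B_i^\top$ is some $B_j$; $B_iB_j=\sum_h p_{ij}^hB_h$ with nonnegative integers $p_{ij}^h$; and $B_iB_j=B_jB_i$. Its *Bose–Mesner algebra* is $\mathrm{span}_{\mathbb C}\{B_0,\dots,B_d\}$. The following are equivalent. 1. $\Gamma$ is distance-regular: for every $x\in X$ the partition $\{\Gamma_0^{\rightarrow}(x),\dots,\Gamma_D^{\rightarrow}(x)\}$ of $X$ is equitable, and its parameters do not depend on $x$. 2. For every $x\in X$ the partition $\{\Gamma_0^{\leftarrow}(x),\dots,\Gamma_D^{\leftarrow}(x)\}$ of $X$ is equitable, and its parameters do not depend on $x$. 3. The relations $R_i=\{(x,y):\partial(x,y)=i\}$ $(0\le i\le D)$ form a commutative association scheme on $X$ (with $D$ classes). 4. $\mathcal A$ is the Bose–Mesner algebra of some commutative $D$-class association scheme on $X$. 5. $A^\top\in\{A_0,\dots,A_D\}$, and there are complex scalars $p^h_{i1}$ with $A_iA=\sum_{h=0}^D p^h_{i1}A_h$ for $0\le i\le D$.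 6. With $\Delta=\{(\partial(x,y),\partial(y,x)):x,y\in X\}$ and $R_{\delta}=\{(x,y):(\partial(x,y),\partial(y,x))=\delta\}$ for $\delta\in\Delta$, the relations $(R_\delta)_{\delta\in\Delta}$ form a commutative $D$-class association scheme on $X$ (in particular $|\Delta|=D+1$). 7. $\Gamma$ is regular (all in- and out-degrees are equal to some $k$), $A$ has exactly $d+1$ distinct eigenvalues with $D=d$, and both $A^\top$ and $A_D$ are polynomials in $A$ with complex coefficients. 8. $\Gamma$ is regular of some valency $k$, $A$ has exactly $d+1$ distinct eigenvalues $\lambda_0=k,\lambda_1,\dots,\lambda_d$ with $D=d$, $A^\top$ is a polynomial in $A$ with complex coefficients, and $$\frac1{|X|}\sum_{x\in X}|\Gamma_D^{\rightarrow}(x)|=|X|\left(\sum_{j=0}^d\frac{|\pi_0|^2}{m(\lambda_j)\,|\pi_j|^2}\right)^{-1},$$ where $m(\lambda_j)$ is the algebraic multiplicity of $\lambda_j$ as an eigenvalue of $A$ and $\pi_i=\prod_{j\ne i}(\lambda_i-\lambda_j)$. -/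

import Mathlib

open scoped Classical in
/-- The `0/1` complex matrix of a binary relation on `X`. -/
noncomputable def relMatrix {X : Type*} (R : X → X → Prop) : Matrix X X ℂ :=
  Matrix.of fun x y => if R x y then 1 else 0

/-- The relations `R i` (`i : ι`) on the finite set `X` are the `d + 1` relations of a commutative
`d`-class association scheme. The relations are pairwise distinct because they are nonempty and
their matrices sum to the all-ones matrix. -/
structure IsCommAssocScheme {X ι : Type*} [Fintype X] [DecidableEq X] [Fintype ι]
    (d : ℕ) (R : ι → X → X → Prop) : Prop where
  card_eq : Fintype.card ι = d + 1
  nonempty : ∀ i, ∃ x y, R i x y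
  exists_one : ∃ i, relMatrix (R i) = 1
  sum_eq : ∑ i, relMatrix (R i) = Matrix.of fun _ _ => 1
  transpose_mem : ∀ i, ∃ j, (relMatrix (R i)).transpose = relMatrix (R j)
  mul_eq : ∃ p : ι → ι → ι → ℕ, ∀ i j,
    relMatrix (R i) * relMatrix (R j) = ∑ h, (p i j h : ℂ) • relMatrix (R h)
  mul_comm : ∀ i j, relMatrix (R i) * relMatrix (R j) = relMatrix (R j) * relMatrix (R i)

/-- The linear span of the matrices of the relations; for a commutative association scheme, this is
its Bose–Mesner algebra. -/
noncomputable def boseMesner {X ι : Type*} (R : ι → X → X → Prop) : Submodule ℂ (Matrix X X ℂ) :=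
  Submodule.span ℂ (Set.range fun i => relMatrix (R i))

namespace Digraph

/-- There is a directed walk of length `n` from `x` to `y`. -/
def HasWalk {X : Type*} (G : Digraph X) (n : ℕ) (x y : X) : Prop :=
  ∃ w : ℕ → X, w 0 = x ∧ w n = y ∧ ∀ i < n, G.Adj (w i) (w (i + 1))

/-- Every vertex can be reached from every vertex by a directed walk. -/
def StronglyConnected {X : Type*} (G : Digraph X) : Prop :=
  ∀ x y, ∃ n, G.HasWalk n x y

/-- The length of a shortest directed walk from `x` to `y` (a shortest walk is a path). -/
noncomputable def dist {X : Type*} (G : Digraph X) (x y : X) : ℕ :=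
  sInf {n | G.HasWalk n x y}

/-- The maximal distance between two vertices. -/
noncomputable def diam {X : Type*} [Fintype X] (G : Digraph X) : ℕ :=
  (Finset.univ : Finset (X × X)).sup fun q => G.dist q.1 q.2

/-- The adjacency matrix. -/
noncomputable def adjMat {X : Type*} (G : Digraph X) : Matrix X X ℂ :=
  relMatrix G.Adj

/-- The relation `{(x, y) | ∂(x, y) = i}`. -/
def distRel {X : Type*} (G : Digraph X) (i : ℕ) (x y : X) : Prop :=
  G.dist x y = i

/-- The distance-`i` matrix. -/
noncomputable def distMat {X : Type*} (G : Digraph X) (i : ℕ) : Matrix X X ℂ :=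
  relMatrix (G.distRel i)

open scoped Classical in
/-- The vertices `z` such that `x → z` is an arc. -/
noncomputable def outNbrs {X : Type*} [Fintype X] (G : Digraph X) (x : X) : Finset X :=
  {z | G.Adj x z}

open scoped Classical in
/-- The vertices `z` such that `z → x` is an arc. -/
noncomputable def inNbrs {X : Type*} [Fintype X] (G : Digraph X) (x : X) : Finset X :=
  {z | G.Adj z x}

/-- The vertices at distance `i` from `x`. -/
noncomputable def outSphere {X : Type*} [Fintype X] (G : Digraph X) (i : ℕ) (x : X) : Finset X :=
  {z | G.dist x z = i}

/-- The vertices from which `x` is at distance `i`. -/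
noncomputable def inSphere {X : Type*} [Fintype X] (G : Digraph X) (i : ℕ) (x : X) : Finset X :=
  {z | G.dist z x = i}

/-- All in-degrees and all out-degrees are equal to `k`. -/
def IsRegular {X : Type*} [Fintype X] (G : Digraph X) (k : ℕ) : Prop :=
  ∀ x, (G.outNbrs x).card = k ∧ (G.inNbrs x).card = k

open scoped Classical in
/-- The cells `P i` form an equitable partition of the vertex set, with corresponding parameters
`dOut i j` and `dIn i j`. -/
structure IsEquitablePartition {X ι : Type*} [Fintype X] (G : Digraph X)
    (P : ι → Finset X) (dOut dIn : ι → ι → ℕ) : Prop where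
  nonempty : ∀ i, (P i).Nonempty
  disjoint : ∀ i j, i ≠ j → Disjoint (P i) (P j)
  cover : ∀ y, ∃ i, y ∈ P i
  out_eq : ∀ i j, ∀ y ∈ P i, (G.outNbrs y ∩ P j).card = dOut i j
  in_eq : ∀ i j, ∀ y ∈ P i, (G.inNbrs y ∩ P j).card = dIn i j

/-- Distance-regularity: for every vertex `x`, the sets of vertices at distance `0, …, D` from `x`
form an equitable partition, with parameters that do not depend on `x`. -/
def IsDistanceRegular {X : Type*} [Fintype X] (G : Digraph X) : Prop :=
  ∃ dOut dIn : Fin (G.diam + 1) → Fin (G.diam + 1) → ℕ, ∀ x,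
    G.IsEquitablePartition (fun i : Fin (G.diam + 1) => G.outSphere i x) dOut dIn

/-- The adjacency algebra: all polynomials in the adjacency matrix. -/
noncomputable def adjAlgebra {X : Type*} [Fintype X] [DecidableEq X] (G : Digraph X) :
    Subalgebra ℂ (Matrix X X ℂ) :=
  Algebra.adjoin ℂ {G.adjMat}

/-- The set `Δ` of all two-way distances `(∂(x, y), ∂(y, x))`. -/
noncomputable def twoWayDists {X : Type*} [Fintype X] (G : Digraph X) : Finset (ℕ × ℕ) :=
  (Finset.univ : Finset (X × X)).image fun q => (G.dist q.1 q.2, G.dist q.2 q.1)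

/-- The relation of having a given two-way distance. -/
def twoWayRel {X : Type*} (G : Digraph X) (δ : ℕ × ℕ) (x y : X) : Prop :=
  (G.dist x y, G.dist y x) = δ

/-- The finite set of distinct (complex) eigenvalues of the adjacency matrix. -/
noncomputable def eigs {X : Type*} [Fintype X] [DecidableEq X] (G : Digraph X) : Finset ℂ :=
  G.adjMat.charpoly.roots.toFinset

theorem mem_eigs {X : Type*} [Fintype X] [DecidableEq X] (G : Digraph X) (μ : ℂ) :
    μ ∈ G.eigs ↔ μ ∈ spectrum ℂ G.adjMat := by
  rw [Matrix.mem_spectrum_iff_isRoot_charpoly, eigs, Multiset.mem_toFinset,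
    Polynomial.mem_roots (Matrix.charpoly_monic _).ne_zero]

/-- The (algebraic) multiplicity `m(μ)` of an eigenvalue of the adjacency matrix. -/
noncomputable def eigMult {X : Type*} [Fintype X] [DecidableEq X] (G : Digraph X) (μ : ℂ) : ℕ :=
  G.adjMat.charpoly.rootMultiplicity μ

/-- The product of `μ - ν` over all eigenvalues `ν` different from `μ`. -/
noncomputable def eigProd {X : Type*} [Fintype X] [DecidableEq X] (G : Digraph X) (μ : ℂ) : ℂ :=
  ∏ ν ∈ G.eigs.erase μ, (μ - ν)

end Digraph

/-! ### Triangular families of vectors -/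

section LinearAlgebra

/-! The hub is condition 3: the distance relations form a scheme. Write D for the diameter and J for
the all-ones matrix. Since A^i is nonzero at a pair at distance i and zero at larger distances, I,
A, …, A^D are independent, so the adjacency algebra has dimension at least D + 1. If the span of
A_0, …, A_D is closed under right multiplication by A, it contains this algebra, and by dimension it
equals it (`StronglyConnected.adjAlgebra_eq_boseMesner`). Once Aᵀ also lies in the algebra, the
scheme axioms follow. This handles conditions 1 and 5; condition 2 is condition 1 for the reversed
digraph, as transposition only permutes the relations of a scheme. In conditions 4 and 6, each class
determines a distance, and D + 1 classes mapping onto D + 1 distances do so bijectively.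

In conditions 7 and 8, A is normal because Aᵀ is a polynomial in A. Hence the algebra is spanned by
the spectral idempotents and its dimension is the number of distinct eigenvalues, here D + 1;
regularity and connectivity put J in it. If A_D lies in it too, then the A^h with h < i and the
(Aᵀ)^(D-h) A_D with h ≥ i form a basis. The first group lives at distances below i, the second at
distances at least i, so the first part of J is the 0/1 matrix of "distance < i"; differences of
these give the A_i.

For the spectral excess, use the inner product tr(MᴴN) and let P be the component of J orthogonal to
I, …, A^(D-1) in the algebra. P equals 1 at all pairs at distance D, so ‖A_D − P‖² is ‖P‖² minus the
number of such pairs, and ‖P‖² is computed from the spectrum. The equality in condition 8 says that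
this gap is zero, that is A_D = P, which is equivalent to A_D lying in the algebra. -/

theorem linearIndependent_of_triangular {K V ι : Type*} [Field K] [AddCommGroup V] [Module K V]
    [Fintype ι] (v : ι → V) (φ : ι → V →ₗ[K] K) (b : ι → ℕ) (hdiag : ∀ i, φ i (v i) ≠ 0)
    (htri : ∀ i j, φ i (v j) ≠ 0 → i ≠ j → b i < b j) : LinearIndependent K v := by
  classical
  rw [Fintype.linearIndependent_iff]
  intro c hc
  by_contra! hne
  -- Among the indices with nonzero coefficient take one of largest weight: its functional kills
  -- every other term of the relation.
  obtain ⟨i, hi, hmax⟩ := Finset.exists_max_image (Finset.univ.filter fun i => c i ≠ 0) b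
    (by obtain ⟨i, hi⟩ := hne; exact ⟨i, by simpa using hi⟩)
  have h0 : ∑ j, c j * φ i (v j) = 0 := by
    have := congrArg (φ i) hc
    simpa using this
  rw [Finset.sum_eq_single i] at h0
  · exact (mul_ne_zero (by simpa using hi) (hdiag i)) h0
  · intro j _ hj
    by_contra hcj
    have h1 := htri i j (right_ne_zero_of_mul hcj) hj.symm
    have h2 := hmax j (by simpa using left_ne_zero_of_mul hcj)
    omega
  · simp

end LinearAlgebra

/-! ### Spectral idempotents of normal matrices -/

namespace Matrix

open Polynomial
open scoped ComplexOrder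

variable {n : Type*} [Fintype n]

/-- Normality gives (P − PᴴP)ᴴ(P − PᴴP) = 0, so P = PᴴP, which is visibly Hermitian. -/
theorem conjTranspose_eq_self_of_idempotent {P : Matrix n n ℂ} (hP : P * P = P)
    (hc : Pᴴ * P = P * Pᴴ) : Pᴴ = P := by
  have hP' : Pᴴ * Pᴴ = Pᴴ := by rw [← conjTranspose_mul, hP]
  have h1 : (P - Pᴴ * P)ᴴ * (P - Pᴴ * P) = 0 := by
    have e1 : Pᴴ * (Pᴴ * P) = Pᴴ * P := by rw [← mul_assoc, hP']
    have e2 : (Pᴴ * P) * P = Pᴴ * P := by rw [mul_assoc, hP]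
    have e3 : (Pᴴ * P) * (Pᴴ * P) = Pᴴ * P := by
      rw [← mul_assoc, mul_assoc Pᴴ, ← hc, ← mul_assoc, hP', mul_assoc, hP]
    rw [conjTranspose_sub, conjTranspose_mul, conjTranspose_conjTranspose, sub_mul, mul_sub,
      mul_sub, e1, e2, e3]
    abel
  have h2 : P = Pᴴ * P := sub_eq_zero.mp (conjTranspose_mul_self_eq_zero.mp h1)
  conv_rhs => rw [h2]
  conv_lhs => rw [h2]
  simp

variable [DecidableEq n]

/-- NᴴN is Hermitian and nilpotent. For Hermitian H one has H² = HᴴH, so H² = 0 forces H = 0, and an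
exponent 2^k can be halved down to 1. -/
theorem eq_zero_of_isNilpotent_of_commute {N : Matrix n n ℂ} (hN : IsNilpotent N)
    (hc : Commute Nᴴ N) : N = 0 := by
  have hH : IsNilpotent (Nᴴ * N) := hc.isNilpotent_mul_left hN
  have herm : (Nᴴ * N)ᴴ = Nᴴ * N := by simp
  have key : ∀ k, ∀ H : Matrix n n ℂ, Hᴴ = H → H ^ (2 ^ k) = 0 → H = 0 := by
    intro k
    induction k with
    | zero => intro H _ h; simpa using h
    | succ k ih =>
      intro H hs h
      have h2 : H ^ 2 = 0 := ih (H ^ 2) (by rw [conjTranspose_pow, hs])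
        (by rw [← pow_mul, ← h, pow_succ'])
      rw [← conjTranspose_mul_self_eq_zero, hs, ← sq, h2]
  obtain ⟨m, hm⟩ := hH
  have : Nᴴ * N = 0 := key m _ herm
    (pow_eq_zero_of_le (Nat.lt_two_pow_self).le hm)
  exact conjTranspose_mul_self_eq_zero.mp this

/-- The finite set of distinct eigenvalues of a complex matrix. -/
noncomputable def eigenvalueSet (A : Matrix n n ℂ) : Finset ℂ := A.charpoly.roots.toFinset

theorem mem_eigenvalueSet {A : Matrix n n ℂ} {μ : ℂ} :
    μ ∈ A.eigenvalueSet ↔ μ ∈ spectrum ℂ A := by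
  rw [Matrix.mem_spectrum_iff_isRoot_charpoly, eigenvalueSet, Multiset.mem_toFinset,
    Polynomial.mem_roots (Matrix.charpoly_monic _).ne_zero]

/-- The spectral idempotent of a diagonalizable matrix, as a Lagrange polynomial in the matrix. -/
noncomputable def eigenIdem (A : Matrix n n ℂ) (μ : ℂ) : Matrix n n ℂ :=
  aeval A (Lagrange.basis A.eigenvalueSet id μ)

theorem eval_eq_zero_of_aeval_eq_zero {A : Matrix n n ℂ} {f : ℂ[X]} (hf : aeval A f = 0) {μ : ℂ}
    (hμ : μ ∈ A.eigenvalueSet) : f.eval μ = 0 := by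
  have h := spectrum.subset_polynomial_aeval A f ⟨μ, mem_eigenvalueSet.mp hμ, rfl⟩
  rw [hf] at h
  by_contra hne
  rw [spectrum.mem_iff, sub_zero] at h
  exact h ((IsUnit.mk0 _ hne).map (algebraMap ℂ (Matrix n n ℂ)))

variable {A : Matrix n n ℂ}

theorem commute_aeval_conjTranspose (hA : Commute Aᴴ A) (f g : ℂ[X]) :
    Commute (aeval A f)ᴴ (aeval A g) := by
  have h1 : ∀ (B : Matrix n n ℂ) (h : ℂ[X]), Commute B A → Commute B (aeval A h) := by
    intro B h hB
    refine Algebra.commute_of_mem_adjoin_of_forall_mem_commute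
      (aeval_mem_adjoin_singleton ℂ A : aeval A h ∈ Algebra.adjoin ℂ {A}) fun b hb => ?_
    rwa [Set.mem_singleton_iff.mp hb]
  apply h1
  have h2 := congrArg conjTranspose (h1 Aᴴ f hA).eq
  simp only [conjTranspose_mul, conjTranspose_conjTranspose] at h2
  exact h2

/-- This is diagonalizability. By Cayley–Hamilton the squarefree product of X − μ over the
eigenvalues gives a nilpotent matrix, since the characteristic polynomial divides a power of it;
this matrix is also normal, hence zero. -/
theorem aeval_nodal_eigenvalueSet (hA : Commute Aᴴ A) :
    aeval A (Lagrange.nodal A.eigenvalueSet id) = 0 := by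
  apply eq_zero_of_isNilpotent_of_commute _ (commute_aeval_conjTranspose hA _ _)
  have hsp : A.charpoly.Splits := IsAlgClosed.splits _
  have hdvd : A.charpoly ∣ (Lagrange.nodal A.eigenvalueSet id) ^ (A.charpoly.roots.card) := by
    conv_lhs => rw [hsp.eq_prod_roots_of_monic A.charpoly_monic]
    have : ∀ s : Multiset ℂ, (∀ a ∈ s, a ∈ A.eigenvalueSet) →
        (s.map fun a => X - C a).prod ∣ (Lagrange.nodal A.eigenvalueSet id) ^ s.card := by
      intro s
      induction s using Multiset.induction_on with
      | empty => simp
      | cons a s ih =>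
        intro h
        rw [Multiset.map_cons, Multiset.prod_cons, Multiset.card_cons, pow_succ']
        exact mul_dvd_mul (Lagrange.X_sub_C_dvd_nodal (v := id)
          (h a (by simp))) (ih fun b hb => h b (by simp [hb]))
    exact this _ fun a ha => by simpa [eigenvalueSet] using ha
  obtain ⟨q, hq⟩ := hdvd
  refine ⟨A.charpoly.roots.card, ?_⟩
  rw [← map_pow, hq, map_mul, aeval_self_charpoly, zero_mul]

theorem aeval_eq_zero_iff (hA : Commute Aᴴ A) (f : ℂ[X]) :
    aeval A f = 0 ↔ ∀ μ ∈ A.eigenvalueSet, f.eval μ = 0 := by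
  refine ⟨fun h μ hμ => eval_eq_zero_of_aeval_eq_zero h hμ, fun h => ?_⟩
  have : Lagrange.nodal A.eigenvalueSet id ∣ f := by
    rw [Lagrange.nodal]
    refine Finset.prod_dvd_of_coprime (fun a _ b _ hab => ?_) fun a ha => ?_
    · exact isCoprime_X_sub_C_of_isUnit_sub (sub_ne_zero.mpr hab).isUnit
    · exact dvd_iff_isRoot.mpr (h a ha)
  obtain ⟨q, rfl⟩ := this
  rw [map_mul, aeval_nodal_eigenvalueSet hA, zero_mul]

theorem aeval_eq_aeval (hA : Commute Aᴴ A) {f g : ℂ[X]}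
    (h : ∀ μ ∈ A.eigenvalueSet, f.eval μ = g.eval μ) : aeval A f = aeval A g := by
  rw [← sub_eq_zero, ← map_sub, aeval_eq_zero_iff hA]
  intro μ hμ
  simp [h μ hμ]

theorem eval_basis_eigenvalueSet {μ ν : ℂ} (hμ : μ ∈ A.eigenvalueSet) (hν : ν ∈ A.eigenvalueSet) :
    (Lagrange.basis A.eigenvalueSet id μ).eval ν = if μ = ν then 1 else 0 := by
  split_ifs with h
  · subst h
    exact Lagrange.eval_basis_self (v := id) (Set.injOn_id _) hμ
  · exact Lagrange.eval_basis_of_ne (v := id) h hν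

theorem aeval_eq_sum_eigenIdem (hA : Commute Aᴴ A) (f : ℂ[X]) :
    aeval A f = ∑ μ ∈ A.eigenvalueSet, f.eval μ • A.eigenIdem μ := by
  have : ∑ μ ∈ A.eigenvalueSet, f.eval μ • A.eigenIdem μ =
      aeval A (∑ μ ∈ A.eigenvalueSet, f.eval μ • Lagrange.basis A.eigenvalueSet id μ) := by
    simp [eigenIdem]
  rw [this]
  apply aeval_eq_aeval hA
  intro ν hν
  rw [eval_finsetSum, Finset.sum_eq_single ν]
  · simp [eval_basis_eigenvalueSet hν hν]
  · intro μ hμ hne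
    simp [eval_basis_eigenvalueSet hμ hν, hne]
  · exact fun h => absurd hν h

theorem aeval_mul_eigenIdem (hA : Commute Aᴴ A) (f : ℂ[X]) {μ : ℂ} (hμ : μ ∈ A.eigenvalueSet) :
    aeval A f * A.eigenIdem μ = f.eval μ • A.eigenIdem μ := by
  rw [eigenIdem, ← map_mul, ← map_smul]
  apply aeval_eq_aeval hA
  intro ν hν
  simp only [eval_mul, eval_smul, eval_basis_eigenvalueSet hμ hν, smul_eq_mul]
  split_ifs with h <;> simp [h]

theorem eigenIdem_mul_eigenIdem (hA : Commute Aᴴ A) {μ ν : ℂ} (hμ : μ ∈ A.eigenvalueSet)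
    (hν : ν ∈ A.eigenvalueSet) :
    A.eigenIdem μ * A.eigenIdem ν = if μ = ν then A.eigenIdem ν else 0 := by
  conv_lhs => rw [eigenIdem, aeval_mul_eigenIdem hA _ hν, eval_basis_eigenvalueSet hμ hν]
  split_ifs <;> simp

theorem conjTranspose_eigenIdem (hA : Commute Aᴴ A) {μ : ℂ} (hμ : μ ∈ A.eigenvalueSet) :
    (A.eigenIdem μ)ᴴ = A.eigenIdem μ := by
  apply conjTranspose_eq_self_of_idempotent
  · simpa using eigenIdem_mul_eigenIdem hA hμ hμ
  · exact (commute_aeval_conjTranspose hA _ _).eq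

theorem linearIndependent_eigenIdem :
    LinearIndependent ℂ (fun μ : A.eigenvalueSet => A.eigenIdem μ) := by
  rw [Fintype.linearIndependent_iff]
  intro c hc ν
  have h : aeval A (∑ μ : A.eigenvalueSet,
      c μ • Lagrange.basis A.eigenvalueSet id (μ : ℂ)) = 0 := by
    simpa [eigenIdem] using hc
  have := eval_eq_zero_of_aeval_eq_zero h ν.2
  rw [eval_finsetSum, Finset.sum_eq_single ν] at this
  · simpa [eval_basis_eigenvalueSet ν.2 ν.2] using this
  · intro μ _ hne
    simp [eval_basis_eigenvalueSet μ.2 ν.2, Subtype.coe_ne_coe.mpr hne]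
  · simp

theorem toSubmodule_adjoin_eq_span_eigenIdem (hA : Commute Aᴴ A) :
    Subalgebra.toSubmodule (Algebra.adjoin ℂ {A}) =
      Submodule.span ℂ (Set.range fun μ : A.eigenvalueSet => A.eigenIdem μ) := by
  apply le_antisymm
  · intro M hM
    rw [Subalgebra.mem_toSubmodule, Algebra.adjoin_singleton_eq_range_aeval] at hM
    obtain ⟨f, rfl⟩ := hM
    change aeval A f ∈ _
    rw [aeval_eq_sum_eigenIdem hA]
    exact Submodule.sum_mem _ fun μ hμ => Submodule.smul_mem _ _
      (Submodule.subset_span ⟨⟨μ, hμ⟩, rfl⟩)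
  · rw [Submodule.span_le]
    rintro _ ⟨μ, rfl⟩
    exact aeval_mem_adjoin_singleton ℂ A

theorem finrank_adjoin_singleton (hA : Commute Aᴴ A) :
    Module.finrank ℂ (Subalgebra.toSubmodule (Algebra.adjoin ℂ {A})) = A.eigenvalueSet.card := by
  rw [toSubmodule_adjoin_eq_span_eigenIdem hA, finrank_span_eq_card linearIndependent_eigenIdem]
  simp

theorem exists_degree_lt_aeval_eq (hA : Commute Aᴴ A) {M : Matrix n n ℂ}
    (hM : M ∈ Algebra.adjoin ℂ {A}) :
    ∃ f : ℂ[X], f.degree < A.eigenvalueSet.card ∧ M = aeval A f := by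
  rw [Algebra.adjoin_singleton_eq_range_aeval] at hM
  obtain ⟨f, rfl⟩ := hM
  refine ⟨Lagrange.interpolate A.eigenvalueSet id fun μ => f.eval μ,
    Lagrange.degree_interpolate_lt _ (Set.injOn_id _), aeval_eq_aeval hA fun μ hμ => ?_⟩
  exact (Lagrange.eval_interpolate_at_node (v := id) (fun μ => f.eval μ) (Set.injOn_id _) hμ).symm

/-- The trace of an idempotent is the dimension of its range. Here the range is the generalized
eigenspace, whose dimension is the algebraic multiplicity. -/
theorem trace_eigenIdem (hA : Commute Aᴴ A) {μ : ℂ} (hμ : μ ∈ A.eigenvalueSet) :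
    trace (A.eigenIdem μ) = A.charpoly.rootMultiplicity μ := by
  have hE : A.eigenIdem μ * A.eigenIdem μ = A.eigenIdem μ := by
    simpa using eigenIdem_mul_eigenIdem hA hμ hμ
  have hidem : IsIdempotentElem (toLin' (A.eigenIdem μ)) := by
    rw [IsIdempotentElem, Module.End.mul_eq_comp, ← toLin'_mul, hE]
  have hproj := LinearMap.IsIdempotentElem.isProj_range _ hidem
  have htr := LinearMap.IsProj.trace hproj
  rw [trace_toLin'_eq] at htr
  rw [htr, ← Matrix.charpoly_toLin', ← LinearMap.finrank_maxGenEigenspace_eq]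
  suffices h : LinearMap.range (toLin' (A.eigenIdem μ)) =
      Module.End.maxGenEigenspace (toLin' A) μ by rw [h]
  have hone : (1 : Matrix n n ℂ) = ∑ ν ∈ A.eigenvalueSet, A.eigenIdem ν := by
    simpa using aeval_eq_sum_eigenIdem hA 1
  ext v
  rw [LinearMap.mem_range, Module.End.mem_maxGenEigenspace]
  constructor
  · rintro ⟨w, rfl⟩
    refine ⟨1, ?_⟩
    have h := aeval_mul_eigenIdem hA X hμ
    rw [aeval_X, eval_X] at h
    rw [pow_one, LinearMap.sub_apply, toLin'_apply, toLin'_apply, mulVec_mulVec, h,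
      smul_mulVec, LinearMap.smul_apply, Module.End.one_apply, sub_self]
  · rintro ⟨k, hk⟩
    refine ⟨v, ?_⟩
    have hk' : (aeval A ((X - C μ) ^ k)) *ᵥ v = 0 := by
      rw [← hk, ← toLin'_apply]
      congr 1
      have hpow : ∀ k : ℕ, toLin' (aeval A ((X - C μ) ^ k)) =
          (toLin' A - μ • (1 : Module.End ℂ (n → ℂ))) ^ k := by
        intro k
        have := aeval_algHom_apply (Matrix.toLinAlgEquiv' (R := ℂ) (n := n)).toAlgHom A
          ((X - C μ) ^ k)
        change _ = toLin' (aeval A ((X - C μ) ^ k)) at this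
        rw [← this]
        simp only [map_pow, map_sub, aeval_X, aeval_C]
        rfl
      exact hpow k
    -- E_ν turns (A − μ)^k into the nonzero scalar (ν − μ)^k, so every component of v other than the
    -- one at μ vanishes.
    have hother : ∀ ν ∈ A.eigenvalueSet, ν ≠ μ → A.eigenIdem ν *ᵥ v = 0 := by
      intro ν hν hne
      have h1 := aeval_mul_eigenIdem hA ((X - C μ) ^ k) hν
      have h2 : A.eigenIdem ν * aeval A ((X - C μ) ^ k) =
          aeval A ((X - C μ) ^ k) * A.eigenIdem ν := by
        rw [eigenIdem, ← map_mul, ← map_mul, _root_.mul_comm]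
      have h3 : (eval ν ((X - C μ) ^ k)) • (A.eigenIdem ν *ᵥ v) = 0 := by
        rw [← smul_mulVec, ← h1, ← h2, ← mulVec_mulVec, hk', mulVec_zero]
      refine (smul_eq_zero.mp h3).resolve_left ?_
      simpa using fun h => absurd (sub_eq_zero.mp h) hne
    rw [toLin'_apply]
    conv_rhs => rw [← one_mulVec v, hone, sum_mulVec, Finset.sum_eq_single_of_mem μ hμ hother]

end Matrix

/-! ### Relation matrices and association schemes -/

section Relations

variable {X ι κ : Type*}

open scoped Classical in
theorem relMatrix_apply (R : X → X → Prop) (x y : X) :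
    relMatrix R x y = if R x y then 1 else 0 := by
  simp [relMatrix]

theorem relMatrix_ne_zero_iff {R : X → X → Prop} {x y : X} : relMatrix R x y ≠ 0 ↔ R x y := by
  classical
  simp [relMatrix_apply]

theorem relMatrix_eq_one_iff {R : X → X → Prop} {x y : X} : relMatrix R x y = 1 ↔ R x y := by
  classical
  simp [relMatrix_apply]

theorem relMatrix_eq_zero_iff {R : X → X → Prop} {x y : X} : relMatrix R x y = 0 ↔ ¬ R x y := by
  classical
  simp [relMatrix_apply]

theorem relMatrix_injective : Function.Injective (relMatrix (X := X)) := by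
  intro R S h
  ext x y
  rw [← relMatrix_ne_zero_iff (R := R), h, relMatrix_ne_zero_iff]

theorem transpose_relMatrix (R : X → X → Prop) :
    (relMatrix R).transpose = relMatrix fun x y => R y x := by
  classical
  ext x y
  simp [relMatrix_apply]

theorem conjTranspose_relMatrix (R : X → X → Prop) :
    (relMatrix R).conjTranspose = (relMatrix R).transpose := by
  classical
  ext x y
  simp [relMatrix_apply, Matrix.conjTranspose_apply, apply_ite]

open scoped Classical in
theorem relMatrix_mul_relMatrix_apply [Fintype X] (R S : X → X → Prop) (x y : X) :
    (relMatrix R * relMatrix S) x y =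
      ((Finset.univ.filter fun z => R x z ∧ S z y).card : ℂ) := by
  simp [Matrix.mul_apply, relMatrix_apply, ← ite_and, and_comm]

/-- The family `R` of relations partitions `X × X`. -/
def IsPairPartition (R : ι → X → X → Prop) : Prop :=
  ∀ x y, ∃! i, R i x y

theorem isPairPartition_iff_sum_eq [Fintype ι] {R : ι → X → X → Prop} :
    IsPairPartition R ↔ ∑ i, relMatrix (R i) = Matrix.of fun _ _ => 1 := by
  classical
  have h : ∀ x y, (∑ i, relMatrix (R i)) x y = ((Finset.univ.filter fun i => R i x y).card : ℂ) := by
    intro x y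
    simp [Matrix.sum_apply, relMatrix_apply]
  constructor
  · intro hR
    ext x y
    obtain ⟨i, hi, hu⟩ := hR x y
    rw [h, Matrix.of_apply, Finset.card_eq_one.mpr ⟨i, ?_⟩, Nat.cast_one]
    ext j
    simp only [Finset.mem_filter, Finset.mem_univ, true_and, Finset.mem_singleton]
    exact ⟨fun hj => hu j hj, fun hj => hj ▸ hi⟩
  · intro hs x y
    have h1 := h x y
    rw [hs, Matrix.of_apply] at h1
    obtain ⟨i, hi⟩ := Finset.card_eq_one.mp (by exact_mod_cast h1.symm)
    have hmem : ∀ j, R j x y ↔ j = i := by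
      intro j
      rw [← Finset.mem_singleton, ← hi]
      simp
    exact ⟨i, (hmem i).mpr rfl, fun j hj => (hmem j).mp hj⟩

theorem IsPairPartition.sum_smul_apply [Fintype ι] {R : ι → X → X → Prop}
    (hR : IsPairPartition R) (c : ι → ℂ) {i : ι} {x y : X} (h : R i x y) :
    (∑ j, c j • relMatrix (R j)) x y = c i := by
  rw [Matrix.sum_apply, Finset.sum_eq_single i]
  · simp [relMatrix_eq_one_iff.mpr h]
  · intro j _ hj
    have : ¬ R j x y := fun h' => hj ((hR x y).unique h' h)
    simp [relMatrix_eq_zero_iff.mpr this]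
  · simp

theorem mem_boseMesner_iff [Fintype X] [Fintype ι] {R : ι → X → X → Prop} {M : Matrix X X ℂ} :
    M ∈ boseMesner R ↔ ∃ c : ι → ℂ, M = ∑ i, c i • relMatrix (R i) := by
  rw [boseMesner, Submodule.mem_span_range_iff_exists_fun]
  exact exists_congr fun c => eq_comm

/-- If a relation matrix lies in the span of the matrices of a partition, then membership in the
relation depends only on the class. -/
theorem apply_eq_of_mem_boseMesner [Fintype X] [Fintype ι] {R : ι → X → X → Prop}
    (hR : IsPairPartition R) {M : Matrix X X ℂ} (hM : M ∈ boseMesner R) {i : ι} {x y x' y' : X}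
    (h : R i x y) (h' : R i x' y') : M x y = M x' y' := by
  obtain ⟨c, rfl⟩ := mem_boseMesner_iff.mp hM
  rw [hR.sum_smul_apply c h, hR.sum_smul_apply c h']

variable [Fintype X] [DecidableEq X] [Fintype ι] [Fintype κ]

theorem IsCommAssocScheme.isPairPartition {d : ℕ} {R : ι → X → X → Prop}
    (h : IsCommAssocScheme d R) : IsPairPartition R :=
  isPairPartition_iff_sum_eq.mpr h.sum_eq

/-- The span of the matrices of a partition of `X × X` comes from a commutative association scheme
as soon as it is closed under transposition and under a commutative multiplication. -/
theorem IsCommAssocScheme.of_boseMesner {d : ℕ} {R : ι → X → X → Prop}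
    (hcard : Fintype.card ι = d + 1) (hne : ∀ i, ∃ x y, R i x y) (hR : IsPairPartition R)
    (hone : ∃ i, relMatrix (R i) = 1)
    (htr : ∀ i, (relMatrix (R i)).transpose ∈ boseMesner R)
    (hmul : ∀ i j, relMatrix (R i) * relMatrix (R j) ∈ boseMesner R)
    (hcomm : ∀ i j, relMatrix (R i) * relMatrix (R j) = relMatrix (R j) * relMatrix (R i)) :
    IsCommAssocScheme d R where
  card_eq := hcard
  nonempty := hne
  exists_one := hone
  sum_eq := isPairPartition_iff_sum_eq.mp hR
  mul_comm := hcomm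
  transpose_mem := by
    -- The transpose of a class is constant on each class, so two classes that meet after reversal
    -- coincide.
    have key : ∀ i j x y x' y', R j x y → R j x' y' → R i y x → R i y' x' := by
      intro i j x y x' y' h h' hi
      have := apply_eq_of_mem_boseMesner hR (htr i) h h'
      rw [transpose_relMatrix] at this
      exact relMatrix_eq_one_iff.mp (this ▸ relMatrix_eq_one_iff.mpr hi)
    intro i
    obtain ⟨y, x, hi⟩ := hne i
    obtain ⟨j, hj, -⟩ := hR x y
    refine ⟨j, ?_⟩
    rw [transpose_relMatrix]
    congr 1
    ext x' y'
    exact ⟨fun h' => key j i y x y' x' hi h' hj, fun h' => key i j x y x' y' hj h' hi⟩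
  mul_eq := by
    classical
    choose a b hab using hne
    -- The intersection number is counted at one representative pair of class h; membership of the
    -- product in the span makes the choice irrelevant.
    refine ⟨fun i j h => (Finset.univ.filter fun z => R i (a h) z ∧ R j z (b h)).card,
      fun i j => ?_⟩
    ext x y
    obtain ⟨h, hh, -⟩ := hR x y
    rw [hR.sum_smul_apply _ hh, apply_eq_of_mem_boseMesner hR (hmul i j) hh (hab h),
      relMatrix_mul_relMatrix_apply]

theorem IsCommAssocScheme.mul_mem {d : ℕ} {R : ι → X → X → Prop} (h : IsCommAssocScheme d R)
    (i j : ι) : relMatrix (R i) * relMatrix (R j) ∈ boseMesner R := by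
  obtain ⟨p, hp⟩ := h.mul_eq
  exact mem_boseMesner_iff.mpr ⟨_, hp i j⟩

theorem IsCommAssocScheme.transpose_mem_boseMesner {d : ℕ} {R : ι → X → X → Prop}
    (h : IsCommAssocScheme d R) (i : ι) : (relMatrix (R i)).transpose ∈ boseMesner R := by
  obtain ⟨j, hj⟩ := h.transpose_mem i
  rw [hj]
  exact Submodule.subset_span ⟨j, rfl⟩

theorem IsCommAssocScheme.reindex {d : ℕ} {R : ι → X → X → Prop} (e : κ ≃ ι)
    (h : IsCommAssocScheme d R) : IsCommAssocScheme d (fun k => R (e k)) := by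
  have hspan : boseMesner (fun k => R (e k)) = boseMesner R := by
    rw [boseMesner, boseMesner, ← e.surjective.range_comp]
    rfl
  refine .of_boseMesner (by rw [Fintype.card_congr e, h.card_eq]) (fun k => h.nonempty _) ?_ ?_
    ?_ ?_ fun i j => h.mul_comm _ _
  · intro x y
    obtain ⟨i, hi, hu⟩ := h.isPairPartition x y
    exact ⟨e.symm i, by simpa using hi, fun k hk => by simp [← hu _ hk]⟩
  · obtain ⟨i, hi⟩ := h.exists_one
    exact ⟨e.symm i, by simpa using hi⟩
  · exact fun k => hspan ▸ h.transpose_mem_boseMesner _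
  · exact fun i j => hspan ▸ h.mul_mem _ _

theorem isCommAssocScheme_reindex_iff {d : ℕ} {R : ι → X → X → Prop} {S : κ → X → X → Prop}
    (e : κ ≃ ι) (hS : ∀ k, S k = R (e k)) : IsCommAssocScheme d S ↔ IsCommAssocScheme d R := by
  obtain rfl : S = fun k => R (e k) := funext hS
  refine ⟨fun h => ?_, fun h => h.reindex e⟩
  simpa using h.reindex e.symm

/-- Reversing all pairs permutes the relations by an involution, so this is only a relabelling. -/
theorem IsCommAssocScheme.flip {d : ℕ} {R : ι → X → X → Prop} (h : IsCommAssocScheme d R) :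
    IsCommAssocScheme d (fun i x y => R i y x) := by
  choose σ hσ using h.transpose_mem
  have hrel : ∀ i, (fun x y => R i y x) = R (σ i) := by
    intro i
    apply relMatrix_injective
    rw [← hσ, transpose_relMatrix]
  have hinv : Function.Involutive σ := by
    intro i
    obtain ⟨x, y, hi⟩ := h.nonempty i
    refine (h.isPairPartition x y).unique ?_ hi
    rw [← hrel, ← hrel]
    exact hi
  exact (isCommAssocScheme_reindex_iff hinv.toPerm hrel).mpr h

/-- Row sums in a commutative association scheme are constant. -/
theorem IsCommAssocScheme.exists_valency {d : ℕ} {R : ι → X → X → Prop}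
    (h : IsCommAssocScheme d R) (i : ι) : ∃ k : ℕ, 0 < k ∧ ∀ x,
      {z | R i x z}.ncard = k ∧ {z | R i z x}.ncard = k := by
  classical
  obtain ⟨o, ho⟩ := h.exists_one
  have hdiag : ∀ x, R o x x := fun x => relMatrix_eq_one_iff.mp (by rw [ho, Matrix.one_apply_eq])
  obtain ⟨j, hj⟩ := h.transpose_mem i
  -- Out- and in-counts are the diagonal entries of B Bᵀ and Bᵀ B. These products agree, and the
  -- diagonal is a single class.
  have hout : ∀ x, (relMatrix (R i) * relMatrix (R j)) x x = ({z | R i x z}.ncard : ℂ) := by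
    intro x
    rw [← hj, transpose_relMatrix, relMatrix_mul_relMatrix_apply, Set.ncard_eq_toFinset_card']
    simp
  have hin : ∀ x, (relMatrix (R i) * relMatrix (R j)) x x = ({z | R i z x}.ncard : ℂ) := by
    intro x
    rw [h.mul_comm, ← hj, transpose_relMatrix, relMatrix_mul_relMatrix_apply,
      Set.ncard_eq_toFinset_card']
    simp
  obtain ⟨a, b, hab⟩ := h.nonempty i
  have hc := fun x => apply_eq_of_mem_boseMesner h.isPairPartition (h.mul_mem i j) (hdiag x)
    (hdiag a)
  refine ⟨{z | R i a z}.ncard, (Set.ncard_pos (Set.toFinite _)).mpr ⟨b, hab⟩, fun x => ?_⟩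
  constructor
  · exact_mod_cast (hout x).symm.trans ((hc x).trans (hout a))
  · exact_mod_cast (hin x).symm.trans ((hc x).trans (hout a))

end Relations

/-! ### Directed walks, distances and reversal -/

namespace Digraph

section Distance

variable {X : Type*} {G : Digraph X}

theorem HasWalk.append {m n : ℕ} {x y z : X} (h : G.HasWalk m x y) (h' : G.HasWalk n y z) :
    G.HasWalk (m + n) x z := by
  obtain ⟨w, h0, hm, hw⟩ := h
  obtain ⟨w', h0', hn', hw'⟩ := h'
  refine ⟨fun i => if i < m then w i else w' (i - m), ?_, ?_, ?_⟩
  · by_cases h : 0 < m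
    · simp [h, h0]
    · obtain rfl : m = 0 := by omega
      simp [h0', ← hm, h0]
  · simp [hn']
  · intro i hi
    rcases lt_trichotomy (i + 1) m with h | h | h
    · simpa [h, (by omega : i < m)] using hw i (by omega)
    · have := hw i (by omega)
      rw [h, hm] at this
      simpa [h, (by omega : i < m), h0'] using this
    · have := hw' (i - m) (by omega)
      rw [show i - m + 1 = i + 1 - m by omega] at this
      simp only [if_neg (by omega : ¬ i + 1 < m), if_neg (by omega : ¬ i < m)]
      exact this

theorem hasWalk_zero {x y : X} : G.HasWalk 0 x y ↔ x = y := by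
  constructor
  · rintro ⟨w, rfl, rfl, -⟩
    rfl
  · rintro rfl
    exact ⟨fun _ => x, rfl, rfl, by simp⟩

theorem hasWalk_one {x y : X} : G.HasWalk 1 x y ↔ G.Adj x y := by
  constructor
  · rintro ⟨w, rfl, rfl, h⟩
    exact h 0 one_pos
  · intro h
    refine ⟨fun i => if i = 0 then x else y, by simp, by simp, fun i hi => ?_⟩
    obtain rfl : i = 0 := by omega
    simpa using h

theorem HasWalk.exists_split {n : ℕ} {x y : X} (h : G.HasWalk n x y) {i : ℕ} (hi : i ≤ n) :
    ∃ z, G.HasWalk i x z ∧ G.HasWalk (n - i) z y := by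
  obtain ⟨w, h0, hn, hw⟩ := h
  refine ⟨w i, ⟨w, h0, rfl, fun j hj => hw j (by omega)⟩,
    ⟨fun j => w (i + j), rfl, ?_, fun j hj => hw (i + j) (by omega)⟩⟩
  simpa [Nat.add_sub_cancel' hi] using hn

theorem hasWalk_add {m n : ℕ} {x y : X} :
    G.HasWalk (m + n) x y ↔ ∃ z, G.HasWalk m x z ∧ G.HasWalk n z y := by
  constructor
  · intro h
    simpa using h.exists_split (Nat.le_add_right m n)
  · rintro ⟨z, h, h'⟩
    exact h.append h'

theorem dist_le {n : ℕ} {x y : X} (h : G.HasWalk n x y) : G.dist x y ≤ n := Nat.sInf_le h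

theorem dist_self (x : X) : G.dist x x = 0 := Nat.le_zero.mp (dist_le (hasWalk_zero.mpr rfl))

theorem dist_le_diam [Fintype X] (x y : X) : G.dist x y ≤ G.diam :=
  Finset.le_sup (f := fun q : X × X => G.dist q.1 q.2) (Finset.mem_univ (x, y))

theorem exists_dist_eq_diam [Fintype X] [Nonempty X] (G : Digraph X) :
    ∃ x y, G.dist x y = G.diam := by
  obtain ⟨q, -, hq⟩ := Finset.exists_mem_eq_sup (Finset.univ : Finset (X × X))
    Finset.univ_nonempty fun q => G.dist q.1 q.2
  exact ⟨q.1, q.2, hq.symm⟩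

theorem StronglyConnected.hasWalk_dist (h : G.StronglyConnected) (x y : X) :
    G.HasWalk (G.dist x y) x y := Nat.sInf_mem (h x y)

theorem StronglyConnected.dist_triangle (h : G.StronglyConnected) (x y z : X) :
    G.dist x z ≤ G.dist x y + G.dist y z :=
  dist_le ((h.hasWalk_dist x y).append (h.hasWalk_dist y z))

theorem StronglyConnected.dist_eq_zero_iff (h : G.StronglyConnected) {x y : X} :
    G.dist x y = 0 ↔ x = y := by
  constructor
  · intro h0
    have := h.hasWalk_dist x y
    rwa [h0, hasWalk_zero] at this
  · rintro rfl
    exact dist_self x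

theorem StronglyConnected.dist_eq_one_iff (h : G.StronglyConnected) (hloop : ∀ x, ¬ G.Adj x x)
    {x y : X} : G.dist x y = 1 ↔ G.Adj x y := by
  constructor
  · intro h1
    have := h.hasWalk_dist x y
    rwa [h1, hasWalk_one] at this
  · intro ha
    have h1 := dist_le (hasWalk_one.mpr ha)
    have h0 : G.dist x y ≠ 0 := fun h0 => hloop x (by rwa [← h.dist_eq_zero_iff.mp h0] at ha)
    omega

theorem StronglyConnected.exists_on_geodesic (h : G.StronglyConnected) {x y : X} {i : ℕ}
    (hi : i ≤ G.dist x y) : ∃ z, G.dist x z = i ∧ G.dist z y = G.dist x y - i := by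
  obtain ⟨z, h1, h2⟩ := (h.hasWalk_dist x y).exists_split hi
  have h3 := dist_le h1
  have h4 := dist_le h2
  have h5 := h.dist_triangle x z y
  exact ⟨z, by omega, by omega⟩

theorem StronglyConnected.exists_dist_eq [Fintype X] [Nonempty X] (h : G.StronglyConnected) {i : ℕ}
    (hi : i ≤ G.diam) : ∃ x y, G.dist x y = i := by
  obtain ⟨x, y, hxy⟩ := G.exists_dist_eq_diam
  obtain ⟨z, hz, -⟩ := h.exists_on_geodesic (hxy ▸ hi)
  exact ⟨x, z, hz⟩

theorem isPairPartition_distRel [Fintype X] (G : Digraph X) :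
    IsPairPartition fun i : Fin (G.diam + 1) => G.distRel i := by
  intro x y
  refine ⟨⟨G.dist x y, Nat.lt_succ_of_le (dist_le_diam x y)⟩, rfl, fun i hi => ?_⟩
  exact Fin.ext (show (i : ℕ) = G.dist x y from Eq.symm hi)

/-- The digraph with all arcs reversed. -/
def reverse (G : Digraph X) : Digraph X := ⟨fun x y => G.Adj y x⟩

theorem HasWalk.reverse {n : ℕ} {x y : X} (h : G.HasWalk n x y) : G.reverse.HasWalk n y x := by
  obtain ⟨w, h0, hn, hw⟩ := h
  refine ⟨fun i => w (n - i), by simpa, by simpa, fun i hi => ?_⟩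
  have := hw (n - (i + 1)) (by omega)
  rwa [show n - (i + 1) + 1 = n - i by omega] at this

theorem hasWalk_reverse_iff {n : ℕ} {x y : X} : G.reverse.HasWalk n x y ↔ G.HasWalk n y x :=
  ⟨fun h => h.reverse, fun h => h.reverse⟩

theorem dist_reverse (x y : X) : G.reverse.dist x y = G.dist y x := by
  simp only [dist, hasWalk_reverse_iff]

theorem diam_reverse [Fintype X] : G.reverse.diam = G.diam := by
  apply le_antisymm
  · refine Finset.sup_le fun q _ => ?_
    rw [dist_reverse]
    exact dist_le_diam _ _
  · refine Finset.sup_le fun q _ => ?_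
    rw [← dist_reverse]
    exact dist_le_diam _ _

theorem StronglyConnected.reverse (h : G.StronglyConnected) : G.reverse.StronglyConnected :=
  fun x y => (h y x).imp fun _ hn => hn.reverse

end Distance

/-! ### The adjacency algebra and its dimension -/

section AdjacencyAlgebra

variable {X : Type*} {G : Digraph X}

theorem distMat_zero [DecidableEq X] (h : G.StronglyConnected) : G.distMat 0 = 1 := by
  ext x y
  simp [distMat, relMatrix_apply, distRel, h.dist_eq_zero_iff, Matrix.one_apply]

theorem distMat_one (h : G.StronglyConnected) (hloop : ∀ x, ¬ G.Adj x x) :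
    G.distMat 1 = G.adjMat := by
  rw [distMat, adjMat]
  congr 1
  ext x y
  exact h.dist_eq_one_iff hloop

theorem conjTranspose_adjMat : G.adjMat.conjTranspose = G.adjMat.transpose :=
  conjTranspose_relMatrix _

theorem StronglyConnected.one_le_diam [Fintype X] [Nontrivial X] (h : G.StronglyConnected) :
    1 ≤ G.diam := by
  obtain ⟨x, y, hxy⟩ := exists_pair_ne X
  have := dist_le_diam (G := G) x y
  have := mt h.dist_eq_zero_iff.mp hxy
  omega

variable [Fintype X]

theorem finrank_boseMesner_distRel_le (G : Digraph X) :
    Module.finrank ℂ (boseMesner fun i : Fin (G.diam + 1) => G.distRel i) ≤ G.diam + 1 := by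
  have := finrank_range_le_card (R := ℂ)
    (fun i : Fin (G.diam + 1) => relMatrix (G.distRel i))
  rwa [Fintype.card_fin] at this

variable [DecidableEq X]

/-- Keeping the entries as natural numbers rules out cancellation, so the support of a power is
exactly the walk relation. -/
theorem exists_natCast_eq_adjMat_pow_apply (G : Digraph X) (n : ℕ) : ∃ c : X → X → ℕ,
    (∀ x y, (G.adjMat ^ n) x y = c x y) ∧ ∀ x y, 0 < c x y ↔ G.HasWalk n x y := by
  classical
  induction n with
  | zero =>
    refine ⟨fun x y => if x = y then 1 else 0, fun x y => by simp [Matrix.one_apply], fun x y => ?_⟩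
    rw [hasWalk_zero]
    by_cases h : x = y <;> simp [h]
  | succ n ih =>
    obtain ⟨c, hc, hpos⟩ := ih
    refine ⟨fun x y => ∑ z, c x z * if G.Adj z y then 1 else 0, fun x y => ?_, fun x y => ?_⟩
    · rw [pow_succ, Matrix.mul_apply]
      simp_rw [hc]
      simp [adjMat, relMatrix_apply]
    · rw [hasWalk_add, Finset.sum_pos_iff]
      refine exists_congr fun z => ?_
      rw [hasWalk_one, ← hpos]
      by_cases h : G.Adj z y <;> simp [h]

theorem adjMat_pow_apply_ne_zero_iff {n : ℕ} {x y : X} :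
    (G.adjMat ^ n) x y ≠ 0 ↔ G.HasWalk n x y := by
  obtain ⟨c, hc, hpos⟩ := G.exists_natCast_eq_adjMat_pow_apply n
  rw [hc, Nat.cast_ne_zero, ← Nat.pos_iff_ne_zero, hpos]

theorem adjMat_pow_apply_eq_zero {n : ℕ} {x y : X} (h : n < G.dist x y) :
    (G.adjMat ^ n) x y = 0 := by
  by_contra hne
  exact h.not_ge (dist_le (adjMat_pow_apply_ne_zero_iff.mp hne))

theorem StronglyConnected.adjMat_pow_dist_apply_ne_zero (h : G.StronglyConnected) (x y : X) :
    (G.adjMat ^ G.dist x y) x y ≠ 0 :=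
  adjMat_pow_apply_ne_zero_iff.mpr (h.hasWalk_dist x y)

theorem adjMat_mem_adjAlgebra (G : Digraph X) : G.adjMat ∈ G.adjAlgebra :=
  Algebra.subset_adjoin rfl

theorem mem_adjAlgebra_iff {M : Matrix X X ℂ} :
    M ∈ G.adjAlgebra ↔ ∃ p : Polynomial ℂ, M = Polynomial.aeval G.adjMat p := by
  rw [adjAlgebra, Algebra.adjoin_singleton_eq_range_aeval, AlgHom.mem_range]
  exact exists_congr fun _ => eq_comm

theorem mul_comm_of_mem_adjAlgebra {M N : Matrix X X ℂ} (hM : M ∈ G.adjAlgebra)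
    (hN : N ∈ G.adjAlgebra) : M * N = N * M := by
  obtain ⟨p, rfl⟩ := mem_adjAlgebra_iff.mp hM
  obtain ⟨q, rfl⟩ := mem_adjAlgebra_iff.mp hN
  rw [← map_mul, ← map_mul, mul_comm]

theorem transpose_mem_adjAlgebra (hA : G.adjMat.transpose ∈ G.adjAlgebra) {M : Matrix X X ℂ}
    (hM : M ∈ G.adjAlgebra) : M.transpose ∈ G.adjAlgebra := by
  refine Algebra.adjoin_induction (p := fun M _ => M.transpose ∈ G.adjAlgebra) ?_ ?_ ?_ ?_ hM
  · rintro _ rfl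
    exact hA
  · intro r
    rw [Algebra.algebraMap_eq_smul_one, Matrix.transpose_smul, Matrix.transpose_one]
    exact G.adjAlgebra.smul_mem G.adjAlgebra.one_mem r
  · intro M N _ _ h h'
    rw [Matrix.transpose_add]
    exact add_mem h h'
  · intro M N _ _ h h'
    rw [Matrix.transpose_mul]
    exact mul_mem h' h

theorem adjAlgebra_le_of_mul_mem {W : Submodule ℂ (Matrix X X ℂ)} (h1 : 1 ∈ W)
    (hmul : ∀ M ∈ W, M * G.adjMat ∈ W) : Subalgebra.toSubmodule G.adjAlgebra ≤ W := by
  intro M hM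
  obtain ⟨p, rfl⟩ := mem_adjAlgebra_iff.mp hM
  rw [Polynomial.aeval_eq_sum_range]
  refine Submodule.sum_mem _ fun i _ => Submodule.smul_mem _ _ ?_
  clear * - h1 hmul
  induction i with
  | zero => simpa using h1
  | succ n ih => exact pow_succ G.adjMat n ▸ hmul _ ih

variable [Nonempty X]

theorem StronglyConnected.linearIndependent_adjMat_pow (h : G.StronglyConnected) :
    LinearIndependent ℂ fun i : Fin (G.diam + 1) => G.adjMat ^ (i : ℕ) := by
  choose a b hab using fun i : Fin (G.diam + 1) => h.exists_dist_eq (Nat.lt_succ_iff.mp i.2)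
  refine linearIndependent_of_triangular _
    (fun i => Matrix.entryLinearMap ℂ ℂ (a i) (b i)) (fun i => i) (fun i => ?_) fun i j hne hij => ?_
  · have := h.adjMat_pow_dist_apply_ne_zero (a i) (b i)
    rwa [hab] at this
  · by_contra hlt
    refine hne (adjMat_pow_apply_eq_zero ?_)
    rw [hab]
    have := Fin.val_ne_of_ne hij
    omega

theorem StronglyConnected.le_finrank_adjAlgebra (h : G.StronglyConnected) :
    G.diam + 1 ≤ Module.finrank ℂ (Subalgebra.toSubmodule G.adjAlgebra) := by
  have h1 := finrank_span_eq_card h.linearIndependent_adjMat_pow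
  rw [Fintype.card_fin] at h1
  rw [← h1]
  apply Submodule.finrank_mono
  rw [Submodule.span_le]
  rintro _ ⟨i, rfl⟩
  exact pow_mem G.adjMat_mem_adjAlgebra _

/-- The span contains I and is stable under right multiplication by A, hence contains the algebra;
its dimension is at most D + 1 and that of the algebra is at least D + 1. -/
theorem StronglyConnected.adjAlgebra_eq_boseMesner (h : G.StronglyConnected)
    (hmul : ∀ i : Fin (G.diam + 1),
      G.distMat i * G.adjMat ∈ boseMesner fun i : Fin (G.diam + 1) => G.distRel i) :
    Subalgebra.toSubmodule G.adjAlgebra =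
      boseMesner fun i : Fin (G.diam + 1) => G.distRel i := by
  refine Submodule.eq_of_le_of_finrank_le (adjAlgebra_le_of_mul_mem ?_ ?_)
    (G.finrank_boseMesner_distRel_le.trans h.le_finrank_adjAlgebra)
  · exact Submodule.subset_span ⟨0, distMat_zero h⟩
  · intro M hM
    obtain ⟨c, rfl⟩ := mem_boseMesner_iff.mp hM
    rw [Finset.sum_mul]
    refine Submodule.sum_mem _ fun i _ => ?_
    rw [smul_mul_assoc]
    exact Submodule.smul_mem _ _ (hmul i)

theorem StronglyConnected.isCommAssocScheme_of_adjAlgebra_eq (h : G.StronglyConnected)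
    (hA : G.adjMat.transpose ∈ G.adjAlgebra)
    (heq : Subalgebra.toSubmodule G.adjAlgebra =
      boseMesner fun i : Fin (G.diam + 1) => G.distRel i) :
    IsCommAssocScheme G.diam fun i : Fin (G.diam + 1) => G.distRel i := by
  have hmem : ∀ i : Fin (G.diam + 1), relMatrix (G.distRel i) ∈ G.adjAlgebra := by
    intro i
    rw [← Subalgebra.mem_toSubmodule, heq]
    exact Submodule.subset_span ⟨i, rfl⟩
  refine .of_boseMesner (Fintype.card_fin _)
    (fun i => h.exists_dist_eq (Nat.lt_succ_iff.mp i.2)) G.isPairPartition_distRel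
    ⟨0, distMat_zero h⟩ (fun i => ?_) (fun i j => ?_)
    fun i j => mul_comm_of_mem_adjAlgebra (hmem i) (hmem j)
  · rw [← heq]
    exact transpose_mem_adjAlgebra hA (hmem i)
  · rw [← heq]
    exact G.adjAlgebra.mul_mem (hmem i) (hmem j)

end AdjacencyAlgebra

end Digraph

/-! ### Equitable partitions and schemes with D classes -/

namespace Digraph

variable {X : Type*} [Fintype X] {G : Digraph X}

theorem mem_outSphere {i : ℕ} {x y : X} : y ∈ G.outSphere i x ↔ G.distRel i x y := by
  simp [outSphere, distRel]

theorem ncard_distRel (G : Digraph X) (i : ℕ) (x : X) :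
    {z | G.distRel i x z}.ncard = (G.outSphere i x).card := by
  rw [← Set.ncard_coe_finset]
  congr 1
  ext z
  simp [mem_outSphere]

theorem mem_twoWayDists (x y : X) : (G.dist x y, G.dist y x) ∈ G.twoWayDists :=
  Finset.mem_image.mpr ⟨(x, y), Finset.mem_univ _, rfl⟩

/-- The first component of a two-way distance. -/
def twoWayFst (G : Digraph X) (δ : G.twoWayDists) : Fin (G.diam + 1) :=
  ⟨δ.1.1, by
    obtain ⟨q, -, hq⟩ := Finset.mem_image.mp δ.2
    rw [← hq]
    exact Nat.lt_succ_of_le (dist_le_diam _ _)⟩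

theorem twoWayFst_surjective [Nonempty X] (h : G.StronglyConnected) :
    Function.Surjective G.twoWayFst := by
  intro i
  obtain ⟨x, y, hxy⟩ := h.exists_dist_eq (Nat.lt_succ_iff.mp i.2)
  exact ⟨⟨_, mem_twoWayDists x y⟩, Fin.ext hxy⟩

section Counting

open scoped Classical in
theorem card_inNbrs_inter_outSphere (G : Digraph X) (j : ℕ) (x y : X) :
    ((G.inNbrs y ∩ G.outSphere j x).card : ℂ) = (G.distMat j * G.adjMat) x y := by
  rw [distMat, adjMat, relMatrix_mul_relMatrix_apply]
  congr 2
  ext z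
  rw [Finset.mem_inter, Finset.mem_filter]
  simp [inNbrs, outSphere, distRel, and_comm]

open scoped Classical in
theorem card_outNbrs_inter_outSphere (G : Digraph X) (j : ℕ) (x y : X) :
    ((G.outNbrs y ∩ G.outSphere j x).card : ℂ) = (G.distMat j * G.adjMat.transpose) x y := by
  rw [distMat, adjMat, transpose_relMatrix, relMatrix_mul_relMatrix_apply]
  congr 2
  ext z
  rw [Finset.mem_inter, Finset.mem_filter]
  simp [outNbrs, outSphere, distRel, and_comm]

theorem isEquitablePartition_reverse_iff {ι : Type*} {P : ι → Finset X} {dOut dIn : ι → ι → ℕ} :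
    G.reverse.IsEquitablePartition P dOut dIn ↔ G.IsEquitablePartition P dIn dOut :=
  ⟨fun h => ⟨h.nonempty, h.disjoint, h.cover, h.in_eq, h.out_eq⟩,
    fun h => ⟨h.nonempty, h.disjoint, h.cover, h.in_eq, h.out_eq⟩⟩

theorem isDistanceRegular_reverse_iff : G.reverse.IsDistanceRegular ↔
    ∃ dOut dIn : Fin (G.diam + 1) → Fin (G.diam + 1) → ℕ, ∀ x,
      G.IsEquitablePartition (fun i : Fin (G.diam + 1) => G.inSphere i x) dOut dIn := by
  have hs : ∀ i x, G.reverse.outSphere i x = G.inSphere i x := by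
    intro i x
    simp [outSphere, inSphere, dist_reverse]
  rw [IsDistanceRegular, diam_reverse]
  simp only [isEquitablePartition_reverse_iff, hs]
  exact exists_comm

end Counting

variable [DecidableEq X]

theorem IsDistanceRegular.isCommAssocScheme [Nonempty X] (h : G.StronglyConnected)
    (hG : G.IsDistanceRegular) :
    IsCommAssocScheme G.diam fun i : Fin (G.diam + 1) => G.distRel i := by
  obtain ⟨dOut, dIn, hd⟩ := hG
  have hcell : ∀ (i : Fin (G.diam + 1)) x y, G.distRel i x y → y ∈ G.outSphere i x := by
    intro i x y hi
    rwa [mem_outSphere]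
  have hspan : Subalgebra.toSubmodule G.adjAlgebra =
      boseMesner fun i : Fin (G.diam + 1) => G.distRel i := by
    refine h.adjAlgebra_eq_boseMesner fun j => mem_boseMesner_iff.mpr ⟨fun i => dIn i j, ?_⟩
    ext x y
    obtain ⟨i, hi, -⟩ := G.isPairPartition_distRel x y
    rw [G.isPairPartition_distRel.sum_smul_apply _ hi, ← card_inNbrs_inter_outSphere,
      (hd x).in_eq i j y (hcell i x y hi)]
  refine h.isCommAssocScheme_of_adjAlgebra_eq ?_ hspan
  rw [← Subalgebra.mem_toSubmodule, hspan]
  -- Cell 0 is {x}, so counting out-neighbours of y in it reads off the entry of Aᵀ at (x, y).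
  refine mem_boseMesner_iff.mpr ⟨fun i => dOut i 0, ?_⟩
  ext x y
  obtain ⟨i, hi, -⟩ := G.isPairPartition_distRel x y
  rw [G.isPairPartition_distRel.sum_smul_apply _ hi, ← (hd x).out_eq i 0 y (hcell i x y hi),
    card_outNbrs_inter_outSphere, Fin.val_zero, distMat_zero h, Matrix.one_mul]

theorem exists_distMat_eq_transpose_adjMat [Nontrivial X]
    (hS : IsCommAssocScheme G.diam fun i : Fin (G.diam + 1) => G.distRel i) (h : G.StronglyConnected)
    (hloop : ∀ x, ¬ G.Adj x x) : ∃ j : Fin (G.diam + 1), G.adjMat.transpose = G.distMat j := by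
  obtain ⟨j, hj⟩ := hS.transpose_mem ⟨1, Nat.lt_succ_of_le h.one_le_diam⟩
  exact ⟨j, by rw [← distMat_one h hloop]; exact hj⟩

theorem distMat_mul_adjMat_mem_boseMesner [Nontrivial X]
    (hS : IsCommAssocScheme G.diam fun i : Fin (G.diam + 1) => G.distRel i) (h : G.StronglyConnected)
    (hloop : ∀ x, ¬ G.Adj x x) (i : Fin (G.diam + 1)) :
    G.distMat i * G.adjMat ∈ boseMesner fun i : Fin (G.diam + 1) => G.distRel i := by
  rw [← distMat_one h hloop]
  exact hS.mul_mem i ⟨1, Nat.lt_succ_of_le h.one_le_diam⟩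

/-- The parameters are structure constants: multiplying A_j by A counts in-neighbours, and by Aᵀ,
itself some A_t, out-neighbours. -/
theorem isDistanceRegular_of_isCommAssocScheme [Nontrivial X]
    (hS : IsCommAssocScheme G.diam fun i : Fin (G.diam + 1) => G.distRel i) (h : G.StronglyConnected)
    (hloop : ∀ x, ¬ G.Adj x x) : G.IsDistanceRegular := by
  obtain ⟨p, hp⟩ := hS.mul_eq
  obtain ⟨t, ht⟩ := exists_distMat_eq_transpose_adjMat hS h hloop
  let o : Fin (G.diam + 1) := ⟨1, Nat.lt_succ_of_le h.one_le_diam⟩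
  have ho : G.adjMat = relMatrix (G.distRel o) := (distMat_one h hloop).symm
  have hcell : ∀ (i : Fin (G.diam + 1)) x y, y ∈ G.outSphere i x → G.distRel i x y := by
    intro i x y hi
    rwa [mem_outSphere] at hi
  refine ⟨fun i j => p j t i, fun i j => p j o i, fun x => ⟨fun i => ?_, fun i j hij => ?_,
    fun y => ?_, fun i j y hy => ?_, fun i j y hy => ?_⟩⟩
  · obtain ⟨k, hk, hv⟩ := hS.exists_valency i
    rw [← Finset.card_pos, ← ncard_distRel, (hv x).1]
    exact hk
  · rw [Finset.disjoint_left]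
    intro y hi hj
    exact hij ((hS.isPairPartition x y).unique (hcell i x y hi) (hcell j x y hj))
  · obtain ⟨i, hi, -⟩ := hS.isPairPartition x y
    exact ⟨i, mem_outSphere.mpr hi⟩
  · have := card_outNbrs_inter_outSphere G j x y
    rw [ht] at this
    change _ = (relMatrix (G.distRel j) * relMatrix (G.distRel t)) x y at this
    rw [hp j t, hS.isPairPartition.sum_smul_apply _ (hcell i x y hy)] at this
    exact_mod_cast this
  · have := card_inNbrs_inter_outSphere G j x y
    rw [ho] at this
    change _ = (relMatrix (G.distRel j) * relMatrix (G.distRel o)) x y at this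
    rw [hp j o, hS.isPairPartition.sum_smul_apply _ (hcell i x y hy)] at this
    exact_mod_cast this

theorem isDistanceRegular_iff_isCommAssocScheme [Nontrivial X] (h : G.StronglyConnected)
    (hloop : ∀ x, ¬ G.Adj x x) : G.IsDistanceRegular ↔
      IsCommAssocScheme G.diam fun i : Fin (G.diam + 1) => G.distRel i :=
  ⟨fun hG => hG.isCommAssocScheme h, fun hS => isDistanceRegular_of_isCommAssocScheme hS h hloop⟩

theorem isCommAssocScheme_reverse_iff :
    (IsCommAssocScheme G.reverse.diam fun i : Fin (G.reverse.diam + 1) => G.reverse.distRel i) ↔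
      IsCommAssocScheme G.diam fun i : Fin (G.diam + 1) => G.distRel i := by
  have hr : ∀ i, G.reverse.distRel i = fun x y => G.distRel i y x := by
    intro i
    ext x y
    rw [distRel, distRel, dist_reverse]
  rw [diam_reverse]
  simp only [hr]
  exact ⟨fun hS => hS.flip, fun hS => hS.flip⟩

/-- Powers of A are constant on each class and their supports determine the distance. So each class
lies in one distance relation, and the resulting surjection between sets of size D + 1 is a
bijection. -/
theorem isCommAssocScheme_of_adjAlgebra_le_boseMesner [Nonempty X] (h : G.StronglyConnected)
    {R : Fin (G.diam + 1) → X → X → Prop} (hR : IsCommAssocScheme G.diam R)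
    (hle : Subalgebra.toSubmodule G.adjAlgebra ≤ boseMesner R) :
    IsCommAssocScheme G.diam fun i : Fin (G.diam + 1) => G.distRel i := by
  have hdist : ∀ i x y x' y', R i x y → R i x' y' → G.dist x y = G.dist x' y' := by
    intro i x y x' y' hi hi'
    rw [dist, dist]
    congr 1
    ext n
    have := apply_eq_of_mem_boseMesner hR.isPairPartition
      (hle (pow_mem G.adjMat_mem_adjAlgebra n)) hi hi'
    rw [Set.mem_ofPred_eq, Set.mem_ofPred_eq, ← adjMat_pow_apply_ne_zero_iff, this,
      adjMat_pow_apply_ne_zero_iff]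
  choose a b hab using hR.nonempty
  let g : Fin (G.diam + 1) → Fin (G.diam + 1) := fun i =>
    ⟨G.dist (a i) (b i), Nat.lt_succ_of_le (dist_le_diam _ _)⟩
  have hg : ∀ i x y, R i x y → (g i : ℕ) = G.dist x y := fun i x y hi =>
    hdist i _ _ _ _ (hab i) hi
  have hsurj : Function.Surjective g := by
    intro j
    obtain ⟨x, y, hxy⟩ := h.exists_dist_eq (Nat.lt_succ_iff.mp j.2)
    obtain ⟨i, hi, -⟩ := hR.isPairPartition x y
    exact ⟨i, Fin.ext ((hg i x y hi).trans hxy)⟩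
  have hbij : Function.Bijective g := ⟨Finite.injective_iff_surjective.mpr hsurj, hsurj⟩
  refine (isCommAssocScheme_reindex_iff (Equiv.ofBijective g hbij) fun i => ?_).mp hR
  ext x y
  refine ⟨fun hi => (hg i x y hi).symm, fun hi => ?_⟩
  obtain ⟨j, hj, -⟩ := hR.isPairPartition x y
  have : j = i := hbij.1 (Fin.ext ((hg j x y hj).trans hi))
  rwa [← this]

theorem isCommAssocScheme_twoWayRel_iff_of_injective [Nonempty X] (h : G.StronglyConnected)
    (hinj : Function.Injective G.twoWayFst) :
    (IsCommAssocScheme G.diam fun δ : G.twoWayDists => G.twoWayRel δ) ↔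
      IsCommAssocScheme G.diam fun i : Fin (G.diam + 1) => G.distRel i := by
  refine isCommAssocScheme_reindex_iff
    (Equiv.ofBijective _ ⟨hinj, twoWayFst_surjective h⟩) fun δ => ?_
  ext x y
  refine ⟨fun hδ => congrArg Prod.fst hδ, fun hδ => ?_⟩
  have : (⟨_, mem_twoWayDists x y⟩ : G.twoWayDists) = δ := hinj (Fin.ext hδ)
  exact congrArg Subtype.val this

/-- Everything reduces to the first coordinate determining the second: in one direction by counting,
in the other because the transpose of a distance relation is a distance relation. -/
theorem isCommAssocScheme_twoWayRel_iff [Nonempty X] (h : G.StronglyConnected) :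
    (IsCommAssocScheme G.diam fun δ : G.twoWayDists => G.twoWayRel δ) ↔
      IsCommAssocScheme G.diam fun i : Fin (G.diam + 1) => G.distRel i := by
  constructor
  · intro hS
    refine (isCommAssocScheme_twoWayRel_iff_of_injective h ?_).mp hS
    have hb := (Fintype.bijective_iff_surjective_and_card G.twoWayFst).mpr
      ⟨twoWayFst_surjective h, by rw [hS.card_eq, Fintype.card_fin]⟩
    exact hb.1
  · intro hS
    refine (isCommAssocScheme_twoWayRel_iff_of_injective h ?_).mpr hS
    rintro ⟨δ, hδ⟩ ⟨ε, hε⟩ heq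
    obtain ⟨⟨x, y⟩, -, rfl⟩ := Finset.mem_image.mp hδ
    obtain ⟨⟨x', y'⟩, -, rfl⟩ := Finset.mem_image.mp hε
    have h1 : G.dist x y = G.dist x' y' := congrArg Fin.val heq
    obtain ⟨i, hi, -⟩ := hS.isPairPartition x y
    obtain ⟨j, hj⟩ := hS.transpose_mem i
    rw [transpose_relMatrix] at hj
    have hj := relMatrix_injective hj
    have e1 : G.dist y x = j := (congrFun (congrFun hj y) x).mp hi
    have e2 : G.dist y' x' = j := (congrFun (congrFun hj y') x').mp (h1.symm.trans hi)
    simp only [h1, e1, e2]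

end Digraph

/-! ### The all-ones matrix as a polynomial in A -/

namespace Digraph

open Matrix Polynomial
open scoped ComplexOrder

variable {X : Type*} [Fintype X] {G : Digraph X}

theorem sum_outNbrs_eq (G : Digraph X) (v : X → ℂ) (x : X) :
    (G.adjMat *ᵥ v) x = ∑ z ∈ G.outNbrs x, v z := by
  classical
  simp [Matrix.mulVec, dotProduct, adjMat, relMatrix_apply, outNbrs, Finset.sum_filter]

/-- The maximum principle for functions harmonic with respect to the out-neighbours. -/
theorem StronglyConnected.apply_eq_of_harmonic (h : G.StronglyConnected) {k : ℕ}
    (hk : ∀ x, (G.outNbrs x).card = k) {u : X → ℝ}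
    (hu : ∀ x, ∑ z ∈ G.outNbrs x, u z = k * u x) (x y : X) : u x = u y := by
  classical
  obtain ⟨m, -, hm⟩ := Finset.exists_max_image Finset.univ u ⟨x, Finset.mem_univ x⟩
  have hstep : ∀ a b, u a = u m → G.Adj a b → u b = u m := by
    intro a b ha hab
    have h0 : ∑ z ∈ G.outNbrs a, (u m - u z) = 0 := by
      rw [Finset.sum_sub_distrib, hu, Finset.sum_const, hk, ha, nsmul_eq_mul, sub_self]
    have := (Finset.sum_eq_zero_iff_of_nonneg
      fun z _ => sub_nonneg.mpr (hm z (Finset.mem_univ z))).mp h0 b (by simpa [outNbrs] using hab)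
    linarith
  have hall : ∀ z, u z = u m := by
    intro z
    obtain ⟨n, w, h0, hn, hw⟩ := h m z
    have : ∀ i ≤ n, u (w i) = u m := by
      intro i
      induction i with
      | zero => simp [h0]
      | succ i ih => exact fun hi => hstep _ _ (ih (by omega)) (hw i (by omega))
    rw [← hn]
    exact this n le_rfl
  rw [hall x, hall y]

theorem StronglyConnected.apply_eq_of_mulVec_eq (h : G.StronglyConnected) {k : ℕ}
    (hk : ∀ x, (G.outNbrs x).card = k) {v : X → ℂ} (hv : G.adjMat *ᵥ v = (k : ℂ) • v) (x y : X) :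
    v x = v y := by
  have hsum : ∀ x, ∑ z ∈ G.outNbrs x, v z = k * v x := by
    intro x
    rw [← sum_outNbrs_eq, hv]
    simp
  apply Complex.ext
  · refine h.apply_eq_of_harmonic hk (u := fun x => (v x).re) (fun x => ?_) x y
    rw [← Complex.re_sum, hsum]
    simp
  · refine h.apply_eq_of_harmonic hk (u := fun x => (v x).im) (fun x => ?_) x y
    rw [← Complex.im_sum, hsum]
    simp

theorem StronglyConnected.linearIndependent_distMat [Nonempty X] (h : G.StronglyConnected) :
    LinearIndependent ℂ fun i : Fin (G.diam + 1) => relMatrix (G.distRel i) := by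
  choose a b hab using fun i : Fin (G.diam + 1) => h.exists_dist_eq (Nat.lt_succ_iff.mp i.2)
  refine linearIndependent_of_triangular _
    (fun i => Matrix.entryLinearMap ℂ ℂ (a i) (b i)) (fun i => i) (fun i => ?_) fun i j hne hij => ?_
  · exact relMatrix_ne_zero_iff.mpr (hab i)
  · have : G.distRel j (a i) (b i) := relMatrix_ne_zero_iff.mp hne
    exact absurd (Fin.ext ((hab i).symm.trans this)) hij

variable [DecidableEq X]

theorem commute_conjTranspose_adjMat (hA : G.adjMat.transpose ∈ G.adjAlgebra) :
    Commute G.adjMatᴴ G.adjMat := by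
  rw [conjTranspose_adjMat]
  exact mul_comm_of_mem_adjAlgebra hA G.adjMat_mem_adjAlgebra

theorem finrank_adjAlgebra (hA : G.adjMat.transpose ∈ G.adjAlgebra) :
    Module.finrank ℂ (Subalgebra.toSubmodule G.adjAlgebra) = G.eigs.card :=
  finrank_adjoin_singleton (commute_conjTranspose_adjMat hA)

theorem aeval_adjMat_mulVec_one {k : ℕ} (hk : ∀ x, (G.outNbrs x).card = k) (f : ℂ[X]) :
    aeval G.adjMat f *ᵥ 1 = f.eval (k : ℂ) • (1 : X → ℂ) := by
  have h1 : G.adjMat *ᵥ 1 = (k : ℂ) • (1 : X → ℂ) := by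
    ext x
    rw [sum_outNbrs_eq]
    simp [hk]
  induction f using Polynomial.induction_on with
  | C a => simp [Algebra.algebraMap_eq_smul_one, smul_mulVec]
  | add p q hp hq => rw [map_add, add_mulVec, hp, hq, eval_add, add_smul]
  | monomial n a ih =>
    rw [pow_succ, ← mul_assoc, map_mul, aeval_X, ← mulVec_mulVec, h1, mulVec_smul, ih, smul_smul]
    congr 1
    simp
    ring

section Hoffman

variable [Nonempty X] {k : ℕ}

/-- The product of X − μ over the eigenvalues annihilates A; applied to the all-ones vector, it must
vanish at k. -/
theorem natCast_mem_eigs (hA : G.adjMat.transpose ∈ G.adjAlgebra)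
    (hk : ∀ x, (G.outNbrs x).card = k) : (k : ℂ) ∈ G.eigs := by
  have h1 := aeval_adjMat_mulVec_one hk (Lagrange.nodal G.eigs id)
  have h2 := aeval_nodal_eigenvalueSet (commute_conjTranspose_adjMat hA)
  change aeval G.adjMat (Lagrange.nodal G.eigs id) = 0 at h2
  rw [h2, zero_mulVec] at h1
  have h3 := congrFun h1 (Classical.arbitrary X)
  simp only [Pi.zero_apply, Pi.smul_apply, Pi.one_apply, smul_eq_mul, mul_one,
    Lagrange.eval_nodal] at h3
  obtain ⟨μ, hμ, h4⟩ := Finset.prod_eq_zero_iff.mp h3.symm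
  rwa [sub_eq_zero.mp h4]

/-- In a regular strongly connected digraph with normal adjacency matrix, the all-ones matrix is
a multiple of the spectral idempotent of the valency. -/
theorem StronglyConnected.allOnes_eq_smul_eigenIdem (h : G.StronglyConnected)
    (hA : G.adjMat.transpose ∈ G.adjAlgebra) (hk : ∀ x, (G.outNbrs x).card = k) :
    (Matrix.of fun _ _ => 1 : Matrix X X ℂ) =
      (Fintype.card X : ℂ) • G.adjMat.eigenIdem (k : ℂ) := by
  have hN := commute_conjTranspose_adjMat hA
  have hmem := natCast_mem_eigs hA hk
  set E := G.adjMat.eigenIdem (k : ℂ) with hE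
  have hAE : G.adjMat * E = (k : ℂ) • E := by
    simpa using aeval_mul_eigenIdem hN Polynomial.X hmem
  -- Columns of E are eigenvectors for k, hence constant by the maximum principle; Hermitian
  -- symmetry then makes the rows constant as well.
  have hcol : ∀ x x' y, E x y = E x' y := by
    intro x x' y
    refine h.apply_eq_of_mulVec_eq hk (v := fun x => E x y) ?_ x x'
    ext z
    exact congrFun (congrFun hAE z) y
  have hherm : ∀ x y, E x y = star (E y x) := by
    intro x y
    rw [← conjTranspose_apply, conjTranspose_eigenIdem hN hmem]
  have hconst : ∀ x y x' y', E x y = E x' y' := by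
    intro x y x' y'
    rw [hcol x x' y, hherm, hcol y y' x', ← hherm]
  have hone : ∀ x, ∑ y, E x y = 1 := by
    intro x
    have h1 := aeval_adjMat_mulVec_one hk (Lagrange.basis G.adjMat.eigenvalueSet id (k : ℂ))
    rw [eval_basis_eigenvalueSet hmem hmem, if_pos rfl, one_smul] at h1
    have := congrFun h1 x
    simpa [hE, eigenIdem, mulVec, dotProduct] using this
  ext x y
  rw [of_apply, Matrix.smul_apply, ← hone x, Finset.sum_congr rfl fun z _ => hconst x z x y]
  simp

theorem StronglyConnected.allOnes_mem_adjAlgebra (h : G.StronglyConnected)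
    (hA : G.adjMat.transpose ∈ G.adjAlgebra) (hk : ∀ x, (G.outNbrs x).card = k) :
    (Matrix.of fun _ _ => 1 : Matrix X X ℂ) ∈ G.adjAlgebra := by
  rw [h.allOnes_eq_smul_eigenIdem hA hk]
  exact G.adjAlgebra.smul_mem (aeval_mem_adjoin_singleton ℂ _) _

end Hoffman

/-! ### Recovering all distance matrices from the last one -/

section LastDistanceMatrix

theorem transpose_pow_mul_distMat_diam_apply_eq_zero (h : G.StronglyConnected) {m : ℕ} {x y : X}
    (hlt : G.dist x y + m < G.diam) : (G.adjMatᵀ ^ m * G.distMat G.diam) x y = 0 := by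
  rw [mul_apply]
  refine Finset.sum_eq_zero fun z _ => ?_
  by_contra hne
  have h1 := left_ne_zero_of_mul hne
  rw [← transpose_pow, transpose_apply, adjMat_pow_apply_ne_zero_iff] at h1
  have h2 : G.dist z y = G.diam := relMatrix_ne_zero_iff.mp (right_ne_zero_of_mul hne)
  have h3 := dist_le h1
  have h4 := h.dist_triangle z x y
  omega

/-- Take z at distance m along a geodesic of length D from a to b. The term at a is positive, and
natural-number entries cannot cancel. -/
theorem exists_transpose_pow_mul_distMat_diam_apply_ne_zero [Nonempty X]
    (h : G.StronglyConnected) {m : ℕ} (hm : m ≤ G.diam) :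
    ∃ x y, G.dist x y = G.diam - m ∧ (G.adjMatᵀ ^ m * G.distMat G.diam) x y ≠ 0 := by
  classical
  obtain ⟨a, b, hab⟩ := G.exists_dist_eq_diam
  obtain ⟨z, h1, h2⟩ := h.exists_on_geodesic (hab ▸ hm)
  refine ⟨z, b, hab ▸ h2, ?_⟩
  obtain ⟨c, hc, hpos⟩ := G.exists_natCast_eq_adjMat_pow_apply m
  have : (G.adjMatᵀ ^ m * G.distMat G.diam) z b =
      ((∑ w, c w z * if G.dist w b = G.diam then 1 else 0 : ℕ) : ℂ) := by
    rw [mul_apply, ← transpose_pow]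
    simp_rw [transpose_apply, hc]
    simp only [distMat, relMatrix_apply, distRel]
    push_cast
    refine Finset.sum_congr rfl fun w _ => ?_
    congr
  rw [this, Nat.cast_ne_zero, ← Nat.pos_iff_ne_zero, Finset.sum_pos_iff]
  refine ⟨a, Finset.mem_univ a, ?_⟩
  rw [if_pos hab, mul_one, hpos, ← h1]
  exact h.hasWalk_dist a z

variable [Nonempty X] {k : ℕ}

/-- If the last distance matrix lies in the adjacency algebra, then so does the matrix of the
relation of being at distance less than `i`: it is the component of the all-ones matrix in the span
of the powers `A ^ h` with `h < i`, along the span of the `(Aᵀ) ^ (D - h) * A_D` with `i ≤ h`. -/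
theorem StronglyConnected.relMatrix_dist_lt_mem_adjAlgebra (h : G.StronglyConnected)
    (hA : G.adjMat.transpose ∈ G.adjAlgebra) (hk : ∀ x, (G.outNbrs x).card = k)
    (hcard : G.eigs.card = G.diam + 1) (hD : G.distMat G.diam ∈ G.adjAlgebra) (i : ℕ) :
    relMatrix (fun x y => G.dist x y < i) ∈ G.adjAlgebra := by
  classical
  set v : Fin (G.diam + 1) → Matrix X X ℂ := fun j =>
    if (j : ℕ) < i then G.adjMat ^ (j : ℕ) else G.adjMatᵀ ^ (G.diam - j) * G.distMat G.diam with hv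
  have hv1 : ∀ j : Fin (G.diam + 1), (j : ℕ) < i → v j = G.adjMat ^ (j : ℕ) :=
    fun j hj => if_pos hj
  have hv2 : ∀ j : Fin (G.diam + 1), ¬ (j : ℕ) < i →
      v j = G.adjMatᵀ ^ (G.diam - j) * G.distMat G.diam := fun j hj => if_neg hj
  have hlow : ∀ j : Fin (G.diam + 1), (j : ℕ) < i → ∀ x y, v j x y ≠ 0 → G.dist x y ≤ j := by
    intro j hj x y hne
    by_contra! hlt
    rw [hv1 j hj] at hne
    exact hne (adjMat_pow_apply_eq_zero hlt)
  have hhigh : ∀ j : Fin (G.diam + 1), ¬ (j : ℕ) < i → ∀ x y, v j x y ≠ 0 → j ≤ G.dist x y := by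
    intro j hj x y hne
    by_contra! hlt
    rw [hv2 j hj] at hne
    exact hne (transpose_pow_mul_distMat_diam_apply_eq_zero h (by omega))
  have hex : ∀ j : Fin (G.diam + 1), ∃ x y, G.dist x y = j ∧ v j x y ≠ 0 := by
    intro j
    by_cases hj : (j : ℕ) < i
    · obtain ⟨x, y, hxy⟩ := h.exists_dist_eq (Nat.lt_succ_iff.mp j.2)
      refine ⟨x, y, hxy, ?_⟩
      rw [hv1 j hj, ← hxy]
      exact h.adjMat_pow_dist_apply_ne_zero x y
    · obtain ⟨x, y, hxy, hne⟩ :=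
        exists_transpose_pow_mul_distMat_diam_apply_ne_zero h (Nat.sub_le G.diam j)
      exact ⟨x, y, by omega, by rwa [hv2 j hj]⟩
  choose a b hab hne using hex
  have hli : LinearIndependent ℂ v := by
    -- The low group vanishes beyond distance j, the high group below it. Weighting the first by j
    -- and the second by D − j makes both triangular, and no cross terms survive.
    refine linearIndependent_of_triangular v (fun j => Matrix.entryLinearMap ℂ ℂ (a j) (b j))
      (fun j => if (j : ℕ) < i then j else G.diam - j) hne fun p q hpq hpq' => ?_
    have hpq : v q (a p) (b p) ≠ 0 := hpq
    have hval := Fin.val_ne_of_ne hpq'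
    have := hab p
    by_cases hq : (q : ℕ) < i
    · have := hlow q hq _ _ hpq
      rw [if_pos hq, if_pos (by omega)]
      omega
    · have := hhigh q hq _ _ hpq
      rw [if_neg hq, if_neg (by omega)]
      omega
  have hmem : ∀ j, v j ∈ G.adjAlgebra := by
    intro j
    by_cases hj : (j : ℕ) < i
    · rw [hv1 j hj]
      exact pow_mem G.adjMat_mem_adjAlgebra _
    · rw [hv2 j hj]
      exact mul_mem (pow_mem hA _) hD
  have hspan : Submodule.span ℂ (Set.range v) = Subalgebra.toSubmodule G.adjAlgebra := by
    apply Submodule.eq_of_le_of_finrank_le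
    · rw [Submodule.span_le]
      rintro _ ⟨j, rfl⟩
      exact hmem j
    · rw [finrank_adjAlgebra hA, hcard, finrank_span_eq_card hli, Fintype.card_fin]
  have hJ : (Matrix.of fun _ _ => 1 : Matrix X X ℂ) ∈ Submodule.span ℂ (Set.range v) := by
    rw [hspan]
    exact h.allOnes_mem_adjAlgebra hA hk
  obtain ⟨c, hc⟩ := (Submodule.mem_span_range_iff_exists_fun ℂ).mp hJ
  -- At distances below i the high terms vanish, so the low part equals J there; at the remaining
  -- pairs the low terms vanish.
  have : relMatrix (fun x y => G.dist x y < i) =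
      ∑ j ∈ Finset.univ.filter (fun j : Fin (G.diam + 1) => (j : ℕ) < i), c j • v j := by
    ext x y
    rw [relMatrix_apply, Matrix.sum_apply]
    split_ifs with hxy
    · have h1 := congrFun (congrFun hc x) y
      rw [of_apply, Matrix.sum_apply] at h1
      rw [← h1]
      symm
      refine Finset.sum_subset (Finset.filter_subset _ _) fun j _ hj => ?_
      have hj : ¬ (j : ℕ) < i := by simpa using hj
      rw [Matrix.smul_apply, smul_eq_zero]
      refine Or.inr (by_contra fun hne => ?_)
      have := hhigh j hj x y hne
      omega
    · refine (Finset.sum_eq_zero fun j hj => ?_).symm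
      have hj : (j : ℕ) < i := by simpa using hj
      rw [Matrix.smul_apply, smul_eq_zero]
      refine Or.inr (by_contra fun hne => ?_)
      have := hlow j hj x y hne
      omega
  rw [this]
  exact sum_mem fun j _ => G.adjAlgebra.smul_mem (hmem j) _

theorem StronglyConnected.isCommAssocScheme_of_distMat_diam_mem (h : G.StronglyConnected)
    (hA : G.adjMat.transpose ∈ G.adjAlgebra) (hk : ∀ x, (G.outNbrs x).card = k)
    (hcard : G.eigs.card = G.diam + 1) (hD : G.distMat G.diam ∈ G.adjAlgebra) :
    IsCommAssocScheme G.diam fun i : Fin (G.diam + 1) => G.distRel i := by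
  classical
  refine h.isCommAssocScheme_of_adjAlgebra_eq hA (Eq.symm ?_)
  apply Submodule.eq_of_le_of_finrank_le
  · rw [boseMesner, Submodule.span_le]
    rintro _ ⟨i, rfl⟩
    have : relMatrix (G.distRel i) = relMatrix (fun x y => G.dist x y < i + 1) -
        relMatrix (fun x y => G.dist x y < i) := by
      ext x y
      rw [Matrix.sub_apply, relMatrix_apply, relMatrix_apply, relMatrix_apply, distRel]
      rcases lt_trichotomy (G.dist x y) i with h | h | h
      · simp [h, h.ne, Nat.lt_succ_of_lt h]
      · simp [h]
      · simp [h.ne', h.not_gt, show ¬ G.dist x y < i + 1 by omega]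
    change relMatrix (G.distRel i) ∈ G.adjAlgebra
    rw [this]
    exact sub_mem (h.relMatrix_dist_lt_mem_adjAlgebra hA hk hcard hD _)
      (h.relMatrix_dist_lt_mem_adjAlgebra hA hk hcard hD _)
  · rw [finrank_adjAlgebra hA, hcard, boseMesner, finrank_span_eq_card h.linearIndependent_distMat,
      Fintype.card_fin]

end LastDistanceMatrix

end Digraph

/-! ### The spectral excess -/

namespace Digraph

open Matrix Polynomial
open scoped ComplexOrder

variable {X : Type*} [Fintype X] {G : Digraph X}

theorem trace_conjTranspose_mul_distMat (M : Matrix X X ℂ) (i : ℕ) :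
    trace (Mᴴ * G.distMat i) = ∑ x, ∑ y ∈ G.outSphere i x, star (M x y) := by
  simp_rw [trace, diag_apply, mul_apply]
  rw [Finset.sum_comm]
  refine Finset.sum_congr rfl fun x _ => ?_
  rw [outSphere, Finset.sum_filter]
  refine Finset.sum_congr rfl fun y _ => ?_
  rw [distMat, relMatrix_apply, distRel, conjTranspose_apply]
  split_ifs <;> simp

variable [DecidableEq X]

theorem eigMult_ne_zero {μ : ℂ} (hμ : μ ∈ G.eigs) : (G.eigMult μ : ℂ) ≠ 0 := by
  rw [Nat.cast_ne_zero, ← Nat.pos_iff_ne_zero, eigMult,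
    Polynomial.rootMultiplicity_pos (Matrix.charpoly_monic _).ne_zero]
  rw [eigs, Multiset.mem_toFinset] at hμ
  exact Polynomial.isRoot_of_mem_roots hμ

theorem eigProd_ne_zero (μ : ℂ) : G.eigProd μ ≠ 0 :=
  Finset.prod_ne_zero_iff.mpr fun _ hν => sub_ne_zero.mpr (Finset.ne_of_mem_erase hν).symm

/-- The element of the adjacency algebra which represents the functional "coefficient of `A ^ D`"
with respect to the trace form, when `A` has `D + 1` distinct eigenvalues. -/
noncomputable def topCoeffMat (G : Digraph X) : Matrix X X ℂ :=
  ∑ μ ∈ G.eigs, ((G.eigMult μ : ℂ) * G.eigProd μ)⁻¹ • G.adjMat.eigenIdem μ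

/-- The trace norm of `topCoeffMat`. -/
noncomputable def topCoeffNormSq (G : Digraph X) : ℝ :=
  ∑ μ ∈ G.eigs, ((G.eigMult μ : ℝ) * ‖G.eigProd μ‖ ^ 2)⁻¹

theorem topCoeffNormSq_pos (hne : G.eigs.Nonempty) : 0 < G.topCoeffNormSq := by
  refine Finset.sum_pos (fun μ hμ => inv_pos.mpr (mul_pos ?_ ?_)) hne
  · have := eigMult_ne_zero hμ
    rw [Nat.cast_ne_zero] at this
    exact_mod_cast Nat.pos_of_ne_zero this
  · exact pow_pos (norm_pos_iff.mpr (eigProd_ne_zero μ)) 2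

theorem trace_eigenIdem_adjMat (hA : G.adjMatᵀ ∈ G.adjAlgebra) {μ : ℂ} (hμ : μ ∈ G.eigs) :
    trace (G.adjMat.eigenIdem μ) = G.eigMult μ :=
  trace_eigenIdem (commute_conjTranspose_adjMat hA) hμ

theorem eigenIdem_mul_topCoeffMat (hA : G.adjMatᵀ ∈ G.adjAlgebra) {μ : ℂ} (hμ : μ ∈ G.eigs) :
    G.adjMat.eigenIdem μ * G.topCoeffMat =
      ((G.eigMult μ : ℂ) * G.eigProd μ)⁻¹ • G.adjMat.eigenIdem μ := by
  rw [topCoeffMat, Finset.mul_sum, Finset.sum_eq_single_of_mem μ hμ]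
  · rw [mul_smul_comm, eigenIdem_mul_eigenIdem (commute_conjTranspose_adjMat hA) hμ hμ, if_pos rfl]
  · intro ν hν hne
    rw [mul_smul_comm, eigenIdem_mul_eigenIdem (commute_conjTranspose_adjMat hA) hμ hν,
      if_neg hne.symm, smul_zero]

theorem trace_eigenIdem_mul_topCoeffMat (hA : G.adjMatᵀ ∈ G.adjAlgebra) {μ : ℂ}
    (hμ : μ ∈ G.eigs) : trace (G.adjMat.eigenIdem μ * G.topCoeffMat) = (G.eigProd μ)⁻¹ := by
  rw [eigenIdem_mul_topCoeffMat hA hμ, trace_smul, trace_eigenIdem_adjMat hA hμ, smul_eq_mul]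
  have := eigMult_ne_zero hμ
  field_simp

/-- Lagrange interpolation gives the top coefficient as the sum of f(μ)/π_μ, and the weights were
chosen so that E_μ contributes exactly 1/π_μ. -/
theorem trace_aeval_mul_topCoeffMat (hA : G.adjMatᵀ ∈ G.adjAlgebra) {f : ℂ[X]}
    (hf : f.degree < G.eigs.card) :
    trace (aeval G.adjMat f * G.topCoeffMat) = f.coeff (G.eigs.card - 1) := by
  rw [Lagrange.coeff_eq_sum (v := id) (Set.injOn_id _) hf,
    aeval_eq_sum_eigenIdem (commute_conjTranspose_adjMat hA), Finset.sum_mul, trace_sum]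
  refine Finset.sum_congr rfl fun μ hμ => ?_
  rw [smul_mul_assoc, trace_smul, trace_eigenIdem_mul_topCoeffMat hA hμ, smul_eq_mul,
    div_eq_mul_inv]
  rfl

theorem conjTranspose_topCoeffMat (hA : G.adjMatᵀ ∈ G.adjAlgebra) :
    G.topCoeffMatᴴ =
      ∑ μ ∈ G.eigs, star (((G.eigMult μ : ℂ) * G.eigProd μ)⁻¹) • G.adjMat.eigenIdem μ := by
  rw [topCoeffMat, conjTranspose_sum]
  refine Finset.sum_congr rfl fun μ hμ => ?_
  rw [conjTranspose_smul, conjTranspose_eigenIdem (commute_conjTranspose_adjMat hA) hμ]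

theorem conjTranspose_topCoeffMat_mem (hA : G.adjMatᵀ ∈ G.adjAlgebra) :
    G.topCoeffMatᴴ ∈ G.adjAlgebra := by
  rw [conjTranspose_topCoeffMat hA]
  exact sum_mem fun μ _ => G.adjAlgebra.smul_mem (aeval_mem_adjoin_singleton ℂ _) _

theorem trace_conjTranspose_topCoeffMat_mul (hA : G.adjMatᵀ ∈ G.adjAlgebra) :
    trace (G.topCoeffMatᴴ * G.topCoeffMat) = G.topCoeffNormSq := by
  rw [conjTranspose_topCoeffMat hA, Finset.sum_mul, trace_sum, topCoeffNormSq, Complex.ofReal_sum]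
  refine Finset.sum_congr rfl fun μ hμ => ?_
  rw [smul_mul_assoc, trace_smul, trace_eigenIdem_mul_topCoeffMat hA hμ, smul_eq_mul]
  have h1 := eigMult_ne_zero hμ
  have h2 := eigProd_ne_zero (G := G) μ
  have h3 : (‖G.eigProd μ‖ ^ 2 : ℂ) = star (G.eigProd μ) * G.eigProd μ := by
    rw [mul_comm]
    exact (Complex.mul_conj' _).symm
  push_cast
  rw [h3, star_inv₀, star_mul', ← mul_inv, mul_assoc]
  simp

/-- An element of the adjacency algebra, at a pair at distance `D`. -/
theorem apply_eq_trace_mul_topCoeffMat (hA : G.adjMatᵀ ∈ G.adjAlgebra)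
    (hcard : G.eigs.card = G.diam + 1) {M : Matrix X X ℂ} (hM : M ∈ G.adjAlgebra) {x y : X}
    (hxy : G.dist x y = G.diam) :
    M x y = trace (M * G.topCoeffMat) * (G.adjMat ^ G.diam) x y := by
  obtain ⟨f, hf, rfl⟩ := exists_degree_lt_aeval_eq (commute_conjTranspose_adjMat hA) hM
  change f.degree < G.eigs.card at hf
  rw [trace_aeval_mul_topCoeffMat hA hf, hcard, Nat.add_sub_cancel]
  have hlt : f.natDegree < G.diam + 1 := by
    rw [← hcard]
    by_cases h0 : f = 0
    · simp [h0, hcard]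
    · exact (Polynomial.natDegree_lt_iff_degree_lt h0).mpr hf
  -- Powers below D vanish at a pair at distance D, leaving only the term in A^D.
  rw [aeval_eq_sum_range' hlt, Matrix.sum_apply, Finset.sum_range_succ, Finset.sum_eq_zero, zero_add,
    Matrix.smul_apply, smul_eq_mul]
  intro i hi
  rw [Matrix.smul_apply, adjMat_pow_apply_eq_zero, smul_zero]
  rw [hxy]
  exact Finset.mem_range.mp hi

variable {k : ℕ}

/-- The component of the all-ones matrix in the orthogonal complement of `I, A, …, A ^ (D - 1)` in
the adjacency algebra. -/
noncomputable def lastPredistMat (G : Digraph X) (k : ℕ) : Matrix X X ℂ :=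
  ((Fintype.card X : ℂ) * (G.eigProd k)⁻¹ / G.topCoeffNormSq) • G.topCoeffMatᴴ

theorem lastPredistMat_mem (hA : G.adjMatᵀ ∈ G.adjAlgebra) :
    G.lastPredistMat k ∈ G.adjAlgebra :=
  G.adjAlgebra.smul_mem (conjTranspose_topCoeffMat_mem hA) _

theorem exists_isRegular_of_isCommAssocScheme [Nontrivial X] (h : G.StronglyConnected)
    (hloop : ∀ x, ¬ G.Adj x x)
    (hS : IsCommAssocScheme G.diam fun i : Fin (G.diam + 1) => G.distRel i) :
    ∃ k, G.IsRegular k := by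
  obtain ⟨k, -, hk⟩ := hS.exists_valency ⟨1, Nat.lt_succ_of_le h.one_le_diam⟩
  have hadj : ∀ x y, G.distRel 1 x y ↔ G.Adj x y := fun x y => h.dist_eq_one_iff hloop
  simp only [hadj] at hk
  refine ⟨k, fun x => ?_⟩
  rw [← Set.ncard_coe_finset, ← Set.ncard_coe_finset]
  simpa [outNbrs, inNbrs] using hk x

variable [Nonempty X]

theorem trace_mul_topCoeffMat_eq_zero_iff (h : G.StronglyConnected)
    (hA : G.adjMatᵀ ∈ G.adjAlgebra) (hcard : G.eigs.card = G.diam + 1) {M : Matrix X X ℂ}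
    (hM : M ∈ G.adjAlgebra) :
    trace (M * G.topCoeffMat) = 0 ↔ ∀ x y, G.dist x y = G.diam → M x y = 0 := by
  constructor
  · intro h0 x y hxy
    rw [apply_eq_trace_mul_topCoeffMat hA hcard hM hxy, h0, zero_mul]
  · intro h0
    obtain ⟨x, y, hxy⟩ := G.exists_dist_eq_diam
    have h1 := apply_eq_trace_mul_topCoeffMat hA hcard hM hxy
    rw [h0 x y hxy] at h1
    exact (mul_eq_zero.mp h1.symm).resolve_right (hxy ▸ h.adjMat_pow_dist_apply_ne_zero x y)

/-- The scalar in `lastPredistMat` makes J − P have zero coefficient at A^D, so J and P agree at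
distance D. -/
theorem lastPredistMat_apply (h : G.StronglyConnected) (hA : G.adjMatᵀ ∈ G.adjAlgebra)
    (hk : ∀ x, (G.outNbrs x).card = k) (hcard : G.eigs.card = G.diam + 1) {x y : X}
    (hxy : G.dist x y = G.diam) : G.lastPredistMat k x y = 1 := by
  have hmem := natCast_mem_eigs hA hk
  have hs : (G.topCoeffNormSq : ℂ) ≠ 0 :=
    Complex.ofReal_ne_zero.mpr (topCoeffNormSq_pos ⟨_, hmem⟩).ne'
  have h0 : trace (((Matrix.of fun _ _ => 1 : Matrix X X ℂ) - G.lastPredistMat k) *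
      G.topCoeffMat) = 0 := by
    rw [sub_mul, trace_sub, lastPredistMat, smul_mul_assoc, trace_smul,
      trace_conjTranspose_topCoeffMat_mul hA, h.allOnes_eq_smul_eigenIdem hA hk, smul_mul_assoc,
      trace_smul, trace_eigenIdem_mul_topCoeffMat hA hmem, smul_eq_mul, smul_eq_mul,
      div_mul_cancel₀ _ hs, sub_self]
  have h1 := (trace_mul_topCoeffMat_eq_zero_iff h hA hcard
    (sub_mem (h.allOnes_mem_adjAlgebra hA hk) (lastPredistMat_mem hA))).mp h0 x y hxy
  exact (sub_eq_zero.mp h1).symm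

/-- The difference B = A_D − P vanishes at distance D. It is therefore orthogonal to A_D by supports
and to P by its zero top coefficient, hence to itself. -/
theorem distMat_diam_eq_lastPredistMat_of_mem (h : G.StronglyConnected)
    (hA : G.adjMatᵀ ∈ G.adjAlgebra) (hk : ∀ x, (G.outNbrs x).card = k)
    (hcard : G.eigs.card = G.diam + 1) (hD : G.distMat G.diam ∈ G.adjAlgebra) :
    G.distMat G.diam = G.lastPredistMat k := by
  set B := G.distMat G.diam - G.lastPredistMat k with hB
  have hBmem : B ∈ G.adjAlgebra := sub_mem hD (lastPredistMat_mem hA)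
  have hB0 : ∀ x y, G.dist x y = G.diam → B x y = 0 := by
    intro x y hxy
    rw [hB, Matrix.sub_apply, lastPredistMat_apply h hA hk hcard hxy, distMat,
      relMatrix_eq_one_iff.mpr (show G.distRel G.diam x y from hxy), sub_self]
  have h1 : trace (Bᴴ * G.distMat G.diam) = 0 := by
    rw [trace_conjTranspose_mul_distMat]
    refine Finset.sum_eq_zero fun x _ => Finset.sum_eq_zero fun y hy => ?_
    rw [hB0 x y (mem_outSphere.mp hy), star_zero]
  have h2 : trace (Bᴴ * G.topCoeffMatᴴ) = 0 := by
    rw [← conjTranspose_mul, trace_conjTranspose, trace_mul_comm,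
      (trace_mul_topCoeffMat_eq_zero_iff h hA hcard hBmem).mpr hB0, star_zero]
  have h3 : trace (Bᴴ * B) = 0 := by
    conv_lhs => rw [hB, mul_sub, trace_sub, ← hB, h1, lastPredistMat, mul_smul_comm, trace_smul, h2]
    simp
  exact sub_eq_zero.mp (trace_conjTranspose_mul_self_eq_zero_iff.mp h3)

/-- The excess gap: the squared trace norm of the difference between the last distance matrix and
the last predistance matrix. -/
theorem trace_conjTranspose_sub_lastPredistMat (h : G.StronglyConnected)
    (hA : G.adjMatᵀ ∈ G.adjAlgebra) (hk : ∀ x, (G.outNbrs x).card = k)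
    (hcard : G.eigs.card = G.diam + 1) :
    trace ((G.distMat G.diam - G.lastPredistMat k)ᴴ * (G.distMat G.diam - G.lastPredistMat k)) =
      (((Fintype.card X : ℝ) ^ 2 * (‖G.eigProd k‖ ^ 2 * G.topCoeffNormSq)⁻¹ -
        ∑ x, ((G.outSphere G.diam x).card : ℝ) : ℝ) : ℂ) := by
  have hmem := natCast_mem_eigs hA hk
  have hs : (G.topCoeffNormSq : ℂ) ≠ 0 :=
    Complex.ofReal_ne_zero.mpr (topCoeffNormSq_pos ⟨_, hmem⟩).ne'
  have h1 : trace ((G.distMat G.diam)ᴴ * G.distMat G.diam) =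
      ∑ x, ((G.outSphere G.diam x).card : ℂ) := by
    rw [trace_conjTranspose_mul_distMat]
    refine Finset.sum_congr rfl fun x _ => ?_
    rw [Finset.card_eq_sum_ones, Nat.cast_sum]
    refine Finset.sum_congr rfl fun y hy => ?_
    rw [distMat, relMatrix_eq_one_iff.mpr (mem_outSphere.mp hy)]
    simp
  -- P is 1 wherever A_D is, so the mixed products also count the pairs at distance D.
  have h2 : trace ((G.lastPredistMat k)ᴴ * G.distMat G.diam) =
      ∑ x, ((G.outSphere G.diam x).card : ℂ) := by
    rw [trace_conjTranspose_mul_distMat]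
    refine Finset.sum_congr rfl fun x _ => ?_
    rw [Finset.card_eq_sum_ones, Nat.cast_sum]
    refine Finset.sum_congr rfl fun y hy => ?_
    rw [lastPredistMat_apply h hA hk hcard (mem_outSphere.mp hy)]
    simp
  have h3 : trace ((G.distMat G.diam)ᴴ * G.lastPredistMat k) =
      ∑ x, ((G.outSphere G.diam x).card : ℂ) := by
    rw [← conjTranspose_conjTranspose (G.lastPredistMat k), ← conjTranspose_mul,
      trace_conjTranspose, h2]
    simp
  have h4 : trace ((G.lastPredistMat k)ᴴ * G.lastPredistMat k) =
      (Fintype.card X : ℂ) ^ 2 * (‖G.eigProd k‖ ^ 2 * G.topCoeffNormSq)⁻¹ := by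
    rw [lastPredistMat, conjTranspose_smul, conjTranspose_conjTranspose, smul_mul_smul_comm,
      trace_smul, trace_mul_comm, trace_conjTranspose_topCoeffMat_mul hA, smul_eq_mul]
    have h5 : (‖G.eigProd k‖ ^ 2 : ℂ) = star (G.eigProd k) * G.eigProd k := by
      rw [mul_comm]
      exact (Complex.mul_conj' _).symm
    have h6 := eigProd_ne_zero (G := G) k
    have h7 : star (G.eigProd k) ≠ 0 := star_ne_zero.mpr h6
    rw [Complex.ofReal_inv, Complex.ofReal_mul, Complex.ofReal_pow, h5]
    simp only [star_div₀, star_mul', star_inv₀, star_natCast]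
    rw [show star (G.topCoeffNormSq : ℂ) = G.topCoeffNormSq from Complex.conj_ofReal _]
    field_simp
  rw [conjTranspose_sub, sub_mul, mul_sub, mul_sub, trace_sub, trace_sub, trace_sub, h1, h2, h3, h4]
  push_cast
  ring

theorem average_excess_eq_iff (h : G.StronglyConnected)
    (hA : G.adjMatᵀ ∈ G.adjAlgebra) (hk : ∀ x, (G.outNbrs x).card = k)
    (hcard : G.eigs.card = G.diam + 1) :
    (1 / (Fintype.card X : ℝ)) * ∑ x, ((G.outSphere G.diam x).card : ℝ) =
        (Fintype.card X : ℝ) *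
          (∑ μ ∈ G.eigs,
            ‖G.eigProd (k : ℂ)‖ ^ 2 / ((G.eigMult μ : ℝ) * ‖G.eigProd μ‖ ^ 2))⁻¹ ↔
      G.distMat G.diam ∈ G.adjAlgebra := by
  have hn : (Fintype.card X : ℝ) ≠ 0 := Nat.cast_ne_zero.mpr Fintype.card_ne_zero
  have hsum : ∑ μ ∈ G.eigs, ‖G.eigProd (k : ℂ)‖ ^ 2 / ((G.eigMult μ : ℝ) * ‖G.eigProd μ‖ ^ 2) =
      ‖G.eigProd (k : ℂ)‖ ^ 2 * G.topCoeffNormSq := by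
    rw [topCoeffNormSq, Finset.mul_sum]
    exact Finset.sum_congr rfl fun μ _ => div_eq_mul_inv _ _
  have hgap := trace_conjTranspose_sub_lastPredistMat h hA hk hcard
  have hiff : (1 / (Fintype.card X : ℝ)) * ∑ x, ((G.outSphere G.diam x).card : ℝ) =
        (Fintype.card X : ℝ) * (‖G.eigProd (k : ℂ)‖ ^ 2 * G.topCoeffNormSq)⁻¹ ↔
      (Fintype.card X : ℝ) ^ 2 * (‖G.eigProd k‖ ^ 2 * G.topCoeffNormSq)⁻¹ -
        ∑ x, ((G.outSphere G.diam x).card : ℝ) = 0 := by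
    rw [one_div, inv_mul_eq_iff_eq_mul₀ hn, ← mul_assoc, ← sq, sub_eq_zero]
    exact eq_comm
  rw [hsum, hiff]
  constructor
  · intro h0
    rw [h0, Complex.ofReal_zero, trace_conjTranspose_mul_self_eq_zero_iff, sub_eq_zero] at hgap
    rw [hgap]
    exact lastPredistMat_mem hA
  · intro hD
    rw [distMat_diam_eq_lastPredistMat_of_mem h hA hk hcard hD, sub_self, mul_zero,
      trace_zero] at hgap
    exact Complex.ofReal_eq_zero.mp hgap.symm

end Digraph

/-! ### The equivalences -/

open Digraph in
theorem theorem1p1 {X : Type*} [Fintype X] [DecidableEq X] [Nontrivial X] (G : Digraph X)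
    (hloop : ∀ x, ¬ G.Adj x x) (hconn : G.StronglyConnected) :
    List.TFAE [
      G.IsDistanceRegular,
      ∃ dOut dIn : Fin (G.diam + 1) → Fin (G.diam + 1) → ℕ, ∀ x,
        G.IsEquitablePartition (fun i : Fin (G.diam + 1) => G.inSphere i x) dOut dIn,
      IsCommAssocScheme G.diam (fun i : Fin (G.diam + 1) => G.distRel i),
      ∃ R : Fin (G.diam + 1) → X → X → Prop, IsCommAssocScheme G.diam R ∧
        Subalgebra.toSubmodule G.adjAlgebra = boseMesner R,
      (∃ i ≤ G.diam, G.adjMat.transpose = G.distMat i) ∧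
        ∃ p : ℕ → ℕ → ℂ, ∀ i ≤ G.diam,
          G.distMat i * G.adjMat = ∑ h ∈ Finset.range (G.diam + 1), p i h • G.distMat h,
      IsCommAssocScheme G.diam (fun δ : G.twoWayDists => G.twoWayRel δ),
      ∃ k d : ℕ, G.IsRegular k ∧ G.eigs.card = d + 1 ∧ G.diam = d ∧
        (∃ p : Polynomial ℂ, G.adjMat.transpose = Polynomial.aeval G.adjMat p) ∧
        (∃ q : Polynomial ℂ, G.distMat G.diam = Polynomial.aeval G.adjMat q),
      ∃ k d : ℕ, G.IsRegular k ∧ G.eigs.card = d + 1 ∧ G.diam = d ∧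
        (∃ p : Polynomial ℂ, G.adjMat.transpose = Polynomial.aeval G.adjMat p) ∧
        (1 / (Fintype.card X : ℝ)) * ∑ x, ((G.outSphere G.diam x).card : ℝ) =
          (Fintype.card X : ℝ) *
            (∑ μ ∈ G.eigs,
              ‖G.eigProd (k : ℂ)‖ ^ 2 / ((G.eigMult μ : ℝ) * ‖G.eigProd μ‖ ^ 2))⁻¹] := by
  have hspan : IsCommAssocScheme G.diam (fun i : Fin (G.diam + 1) => G.distRel i) →
      Subalgebra.toSubmodule G.adjAlgebra = boseMesner fun i : Fin (G.diam + 1) => G.distRel i :=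
    fun hS => hconn.adjAlgebra_eq_boseMesner (distMat_mul_adjMat_mem_boseMesner hS hconn hloop)
  tfae_have 1 ↔ 3 := isDistanceRegular_iff_isCommAssocScheme hconn hloop
  tfae_have 2 ↔ 3 := by
    rw [← isDistanceRegular_reverse_iff, ← isCommAssocScheme_reverse_iff]
    exact isDistanceRegular_iff_isCommAssocScheme hconn.reverse hloop
  tfae_have 3 → 4 := fun hS => ⟨_, hS, hspan hS⟩
  tfae_have 4 → 3 := fun ⟨_, hR, heq⟩ =>
    isCommAssocScheme_of_adjAlgebra_le_boseMesner hconn hR heq.le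
  tfae_have 3 → 5 := by
    intro hS
    obtain ⟨j, hj⟩ := exists_distMat_eq_transpose_adjMat hS hconn hloop
    refine ⟨⟨j, Nat.lt_succ_iff.mp j.2, hj⟩, ?_⟩
    choose c hc using fun i : Fin (G.diam + 1) =>
      mem_boseMesner_iff.mp (distMat_mul_adjMat_mem_boseMesner hS hconn hloop i)
    -- The scalars are extended by 0 outside 0, …, D, where they are never used.
    refine ⟨fun i h => if hi : i < G.diam + 1 then
      if hh : h < G.diam + 1 then c ⟨i, hi⟩ ⟨h, hh⟩ else 0 else 0, fun i hi => ?_⟩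
    rw [hc ⟨i, Nat.lt_succ_of_le hi⟩, Finset.sum_range]
    refine Finset.sum_congr rfl fun h _ => ?_
    simp only [dif_pos (Nat.lt_succ_of_le hi), dif_pos h.2]
    rfl
  tfae_have 5 → 3 := by
    rintro ⟨⟨j, hj, hjt⟩, p, hp⟩
    have heq := hconn.adjAlgebra_eq_boseMesner fun i => mem_boseMesner_iff.mpr
      ⟨fun h => p i h, (hp i (Nat.lt_succ_iff.mp i.2)).trans (Finset.sum_range _)⟩
    refine hconn.isCommAssocScheme_of_adjAlgebra_eq ?_ heq
    rw [← Subalgebra.mem_toSubmodule, heq, hjt]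
    exact Submodule.subset_span ⟨⟨j, Nat.lt_succ_of_le hj⟩, rfl⟩
  tfae_have 6 ↔ 3 := isCommAssocScheme_twoWayRel_iff hconn
  tfae_have 3 → 7 := by
    intro hS
    obtain ⟨k, hk⟩ := exists_isRegular_of_isCommAssocScheme hconn hloop hS
    have hmem : ∀ i : Fin (G.diam + 1), G.distMat i ∈ G.adjAlgebra := by
      intro i
      rw [← Subalgebra.mem_toSubmodule, hspan hS]
      exact Submodule.subset_span ⟨i, rfl⟩
    obtain ⟨j, hj⟩ := exists_distMat_eq_transpose_adjMat hS hconn hloop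
    have hA : G.adjMat.transpose ∈ G.adjAlgebra := hj ▸ hmem j
    refine ⟨k, G.diam, hk, ?_, rfl, mem_adjAlgebra_iff.mp hA,
      mem_adjAlgebra_iff.mp (hmem (Fin.last _))⟩
    -- The number of eigenvalues is the dimension of the algebra, squeezed between D + 1 independent
    -- powers and D + 1 spanning distance matrices.
    rw [← finrank_adjAlgebra hA]
    refine le_antisymm ?_ hconn.le_finrank_adjAlgebra
    rw [hspan hS]
    exact G.finrank_boseMesner_distRel_le
  tfae_have 7 → 3 := by
    rintro ⟨k, d, hk, hcard, rfl, hA, hD⟩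
    exact hconn.isCommAssocScheme_of_distMat_diam_mem (mem_adjAlgebra_iff.mpr hA)
      (fun x => (hk x).1) hcard (mem_adjAlgebra_iff.mpr hD)
  tfae_have 7 ↔ 8 := by
    refine exists_congr fun k => exists_congr fun d => ?_
    constructor
    · rintro ⟨hk, hcard, rfl, hA, hD⟩
      exact ⟨hk, hcard, rfl, hA, (average_excess_eq_iff hconn (mem_adjAlgebra_iff.mpr hA)
        (fun x => (hk x).1) hcard).mpr (mem_adjAlgebra_iff.mpr hD)⟩
    · rintro ⟨hk, hcard, rfl, hA, hD⟩
      exact ⟨hk, hcard, rfl, hA, mem_adjAlgebra_iff.mp ((average_excess_eq_iff hconn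
        (mem_adjAlgebra_iff.mpr hA) (fun x => (hk x).1) hcard).mp hD)⟩
  tfae_finish
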